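/- Let $\mathbb{M}$ be a logical model category, i.e. a model category in which acyclic cofibrations are stable under pullback along fibrations and in which pullback $p^*\colon \mathbb{M}/B\to\mathbb{M}/E$ along every fibration $p\colon E\to B$ has a right adjoint. Assume that every fibrant object of $\mathbb{M}$ is cofibrant and that cofibrations are stable under pullback. Call a fibration $q\colon X\to Y$ $(-1)$-truncated if the path object fibration $P_YX\to X\times_YX$ has a section (where $X\to P_YX\to X\times_Y X$ factors the diagonal into an acyclic cofibration and a fibration), and call a map $(-1)$-truncated if in every factorization of it into an acyclic cofibration followed by a fibration the fibration is $(-1)$-truncated. Assume that the $(-1)$-truncated maps form the right class of a homotopy factorization system on $\mathbb{M}$, where the conditions of such a system (invariance of both classes under weak equivalences, weak factorization system given by the left class intersected with cofibrations and the right class intersected with fibrations, cancellation properties) are required on the full subcategory of bifibrant objects; maps in its left class are called $(-1)$-connected. For a fibration $p\colon E\to B$ with $B$ fibrant let $\mathrm{Fun}(p)\to B\times B$ be the internal hom $[\pi_1^*E,\pi_2^*E]_{B\times B}$, and let $\mathrm{Equiv}(p)\to\mathrm{Fun}(p)$ be the object of fibrewise maps $f\colon E_a\to E_b$ equipped with maps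 $g,h\colon E_b\to E_a$, a path in $[E_a,E_a]$ from $gf$ to $1$, and a path in $[E_b,E_b]$ from $fh$ to $1$. The fibration $p$ is univalent if the map $B\to\mathrm{Equiv}(p)$ given by the identities is a (homotopy) equivalence. A commutative square from a fibration $q\colon X\to Y$ to a fibration $p\colon E\to B$ with base map $b\colon Y\to B$ is homotopy cartesian if $X\to Y\times_BE$ is a weak equivalence. Fix a fibration $\pi\colon\tilde U\to U$ with $U$ fibrant. A fibration $p\colon E\to B$ is $\pi$-small if there is a homotopy cartesian square from $p$ to $\pi$; the base map $b\colon B\to U$ of such a square is called a classifying map. A univalent completion of a $\pi$-small fibration $p\colon E\to B$ with $B$ fibrant is a homotopy cartesian square $$\begin{array}{ccc}E&\to&u(E)\\ {\scriptstyle p}\downarrow&&\downarrow{\scriptstyle u(p)}\\ B&\xrightarrow{\ \iota\ }&u(B)\end{array}$$ such that $\iota$ is $(-1)$-connected and $u(p)$ is a $\pi$-small univalent fibration with $u(B)$ fibrant. **Proposition.** Suppose that $\pi$ is univalent. Then every $\pi$-small fibration $p\colon E\to B$ with $B$ fibrant has a univalent completion. More precisely, for every homotopy cartesian square from $p$ to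 $\pi$ with base map $b\colon B\to U$, the map $b$ factors as a $(-1)$-connected cofibration $\iota\colon B\to u(B)$ followed by a $(-1)$-truncated fibration $m\colon u(B)\to U$; and for every factorization $b=m\iota$ with $\iota$ $(-1)$-connected and $m$ a $(-1)$-truncated fibration, the induced square from $p$ to the pullback $u(p):=m^*\pi\colon m^*\tilde U\to u(B)$, with base map $\iota$, is a univalent completion of $p$. -/

import Mathlib

open CategoryTheory CategoryTheory.Limits HomotopicalAlgebra

universe v u

noncomputable section

namespace UnivalentCompletion

variable {M : Type u} [Category.{v} M]

/-! ### The ambient model category -/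

/-- A logical model category: trivial cofibrations are stable under pullback along fibrations
(the Frobenius property), and pullback along any fibration has a right adjoint. -/
class IsLogicalModelCategory (M : Type u) [Category.{v} M] [ModelCategory M] : Prop where
  frobenius : ∀ {A X Y Z : M} {i' : A ⟶ X} {q : A ⟶ Y} {p : X ⟶ Z} {i : Y ⟶ Z},
    IsPullback i' q p i → Fibration p → trivialCofibrations M i → trivialCofibrations M i'
  pullback_isLeftAdjoint : ∀ {X Y : M} (p : X ⟶ Y), Fibration p →
    (Over.pullback p).IsLeftAdjoint

section ModelCategory

variable [ModelCategory M]

/-- A chosen path object factorization of the relative diagonal `E ⟶ E ×_B E` of a map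
`p : E ⟶ B`, as a trivial cofibration `r` followed by a fibration `P_B E ⟶ E ×_B E`. -/
def pathFactorization {E B : M} (p : E ⟶ B) :
    MorphismProperty.MapFactorizationData (trivialCofibrations M) (fibrations M)
      (pullback.diagonal p) :=
  MorphismProperty.factorizationData _ _ _

/-- A fibration `p : E ⟶ B` is `(-1)`-truncated if the path object fibration
`P_B E ⟶ E ×_B E` has a section. -/
def IsTruncatedFibration {E B : M} (p : E ⟶ B) : Prop :=
  ∃ σ : pullback p p ⟶ (pathFactorization p).Z, σ ≫ (pathFactorization p).p = 𝟙 _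

/-- The class of `(-1)`-truncated maps: for any factorization into a trivial cofibration followed
by a fibration, the fibration is `(-1)`-truncated. -/
def truncatedMaps (M : Type u) [Category.{v} M] [ModelCategory M] : MorphismProperty M :=
  fun E B f => ∀ (Z : M) (j : E ⟶ Z) (p : Z ⟶ B), trivialCofibrations M j → Fibration p →
    j ≫ p = f → IsTruncatedFibration p

/-- A homotopy factorization system `(L, R)` on a model category: both classes are invariant under
weak equivalence, `L` restricted to cofibrations and `R` restricted to fibrations form a weak
factorization system, `L` has the right cancellation property and `R` has the left cancellation
property. The conditions are imposed on the full subcategory of bifibrant objects (which carries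
the homotopy theory of `M`). -/
structure IsHomotopyFactorizationSystem (L R : MorphismProperty M) : Prop where
  left_invariant : ∀ {X Y X' Y' : BifibrantObject M} {f : X.obj ⟶ Y.obj} {f' : X'.obj ⟶ Y'.obj}
    {a : X.obj ⟶ X'.obj} {b : Y.obj ⟶ Y'.obj}, CommSq a f f' b →
    WeakEquivalence a → WeakEquivalence b → (L f ↔ L f')
  right_invariant : ∀ {X Y X' Y' : BifibrantObject M} {f : X.obj ⟶ Y.obj} {f' : X'.obj ⟶ Y'.obj}
    {a : X.obj ⟶ X'.obj} {b : Y.obj ⟶ Y'.obj}, CommSq a f f' b →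
    WeakEquivalence a → WeakEquivalence b → (R f ↔ R f')
  weakFactorizationSystem : MorphismProperty.IsWeakFactorizationSystem
    ((L ⊓ cofibrations M).inverseImage BifibrantObject.ι)
    ((R ⊓ fibrations M).inverseImage BifibrantObject.ι)
  left_cancel : ∀ {X Y Z : BifibrantObject M} (f : X.obj ⟶ Y.obj) (g : Y.obj ⟶ Z.obj),
    L f → L (f ≫ g) → L g
  right_cancel : ∀ {X Y Z : BifibrantObject M} (f : X.obj ⟶ Y.obj) (g : Y.obj ⟶ Z.obj),
    R g → R (f ≫ g) → R f

end ModelCategory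

/-! ### Fibrewise maps and the object `Fun(p)` -/

section Fibrewise

variable [HasPullbacks M] {E B : M} (p : E ⟶ B)

/-- For `a b : T ⟶ B`, a map `a^*E ⟶ b^*E` over `T`, given by its component in `E`. -/
@[ext]
structure FibMap {T : M} (a b : T ⟶ B) where
  hom : pullback a p ⟶ E
  w : hom ≫ p = pullback.fst a p ≫ b

namespace FibMap

variable {p}

/-- The identity of `a^*E`. -/
@[simps]
def id {T : M} (a : T ⟶ B) : FibMap p a a where
  hom := pullback.snd a p
  w := pullback.condition.symm

/-- Composition (in diagrammatic order) of fibrewise maps `a^*E ⟶ b^*E ⟶ c^*E`. -/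
@[simps]
def comp {T : M} {a b c : T ⟶ B} (φ : FibMap p a b) (ψ : FibMap p b c) : FibMap p a c where
  hom := pullback.lift (pullback.fst a p) φ.hom φ.w.symm ≫ ψ.hom
  w := by rw [Category.assoc, ψ.w, pullback.lift_fst_assoc]

/-- Reindexing of fibrewise maps along `u : T' ⟶ T`. -/
@[simps]
def reindex {T T' : M} {a b : T ⟶ B} {a' b' : T' ⟶ B} (φ : FibMap p a b) (u : T' ⟶ T)
    (ha : u ≫ a = a') (hb : u ≫ b = b') : FibMap p a' b' where
  hom := pullback.lift (pullback.fst a' p ≫ u) (pullback.snd a' p)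
    (by rw [Category.assoc, ha, pullback.condition]) ≫ φ.hom
  w := by rw [Category.assoc, φ.w, pullback.lift_fst_assoc, Category.assoc, hb]

lemma reindex_reindex {T T' T'' : M} {a b : T ⟶ B} {a' b' : T' ⟶ B} {a'' b'' : T'' ⟶ B}
    (φ : FibMap p a b) (u : T' ⟶ T) (ha : u ≫ a = a') (hb : u ≫ b = b')
    (u' : T'' ⟶ T') (ha' : u' ≫ a' = a'') (hb' : u' ≫ b' = b'') :
    (φ.reindex u ha hb).reindex u' ha' hb' =
      φ.reindex (u' ≫ u) (by rw [Category.assoc, ha, ha']) (by rw [Category.assoc, hb, hb']) := by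
  ext
  simp only [reindex_hom, ← Category.assoc]
  congr 1
  apply pullback.hom_ext <;> simp [pullback.lift_fst, pullback.lift_snd,
    pullback.lift_fst_assoc]

lemma reindex_comp {T T' : M} {a b c : T ⟶ B} {a' b' c' : T' ⟶ B}
    (φ : FibMap p a b) (ψ : FibMap p b c) (u : T' ⟶ T)
    (ha : u ≫ a = a') (hb : u ≫ b = b') (hc : u ≫ c = c') :
    (φ.comp ψ).reindex u ha hc = (φ.reindex u ha hb).comp (ψ.reindex u hb hc) := by
  ext
  simp only [reindex_hom, comp_hom, ← Category.assoc]
  congr 1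
  apply pullback.hom_ext <;> simp [pullback.lift_fst, pullback.lift_snd,
    pullback.lift_fst_assoc]

lemma reindex_id {T T' : M} {a : T ⟶ B} {a' : T' ⟶ B} (u : T' ⟶ T) (ha : u ≫ a = a') :
    (FibMap.id (p := p) a).reindex u ha ha = FibMap.id a' := by
  ext
  simp [pullback.lift_snd]

lemma id_comp {T : M} {a b : T ⟶ B} (φ : FibMap p a b) : (FibMap.id a).comp φ = φ := by
  ext
  simp only [comp_hom, id_hom]
  convert Category.id_comp φ.hom
  apply pullback.hom_ext <;> simp

end FibMap

variable [HasBinaryProducts M]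

/-- The projection `π₁^* E ⟶ B × B`. -/
abbrev srcFamily : pullback (prod.fst : B ⨯ B ⟶ B) p ⟶ B ⨯ B := pullback.fst _ _

/-- The projection `π₂^* E ⟶ B × B`. -/
abbrev tgtFamily : pullback (prod.snd : B ⨯ B ⟶ B) p ⟶ B ⨯ B := pullback.fst _ _

/-- The map `T ×_{B × B} π₁^* E ⟶ a^* E` for `(a, b) : T ⟶ B × B`. -/
def toFib {T : M} (h : T ⟶ B ⨯ B) :
    pullback h (srcFamily p) ⟶ pullback (h ≫ prod.fst) p :=
  pullback.lift (pullback.fst _ _) (pullback.snd _ _ ≫ pullback.snd _ _)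
    (by rw [pullback.condition_assoc, Category.assoc, pullback.condition])

/-- The map `a^* E ⟶ T ×_{B × B} π₁^* E` for `(a, b) : T ⟶ B × B`. -/
def ofFib {T : M} (h : T ⟶ B ⨯ B) :
    pullback (h ≫ prod.fst) p ⟶ pullback h (srcFamily p) :=
  pullback.lift (pullback.fst _ _)
    (pullback.lift (pullback.fst _ _ ≫ h) (pullback.snd _ _)
      (by rw [Category.assoc, pullback.condition]))
    (by rw [pullback.lift_fst])

lemma ofFib_fst {T : M} (h : T ⟶ B ⨯ B) :
    ofFib p h ≫ pullback.fst _ _ = pullback.fst _ _ := pullback.lift_fst _ _ _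

lemma toFib_fst {T : M} (h : T ⟶ B ⨯ B) :
    toFib p h ≫ pullback.fst _ _ = pullback.fst _ _ := pullback.lift_fst _ _ _

lemma ofFib_toFib {T : M} (h : T ⟶ B ⨯ B) : ofFib p h ≫ toFib p h = 𝟙 _ := by
  apply pullback.hom_ext
  · rw [Category.assoc, toFib_fst, ofFib_fst, Category.id_comp]
  · rw [Category.assoc, toFib, pullback.lift_snd, ofFib, pullback.lift_snd_assoc,
      pullback.lift_snd, Category.id_comp]

lemma toFib_ofFib {T : M} (h : T ⟶ B ⨯ B) : toFib p h ≫ ofFib p h = 𝟙 _ := by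
  apply pullback.hom_ext
  · rw [Category.assoc, ofFib_fst, toFib_fst, Category.id_comp]
  · rw [Category.assoc, ofFib, pullback.lift_snd, Category.id_comp]
    apply pullback.hom_ext
    · rw [Category.assoc, pullback.lift_fst, reassoc_of% (toFib_fst p h), pullback.condition]
    · rw [Category.assoc, pullback.lift_snd, toFib, pullback.lift_snd]

/-- A fibrewise map as a map `T ×_{B × B} π₁^* E ⟶ π₂^* E`. -/
def FibMap.toTgt {T : M} {h : T ⟶ B ⨯ B} (φ : FibMap p (h ≫ prod.fst) (h ≫ prod.snd)) :
    pullback h (srcFamily p) ⟶ pullback (prod.snd : B ⨯ B ⟶ B) p :=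
  pullback.lift (pullback.fst _ _ ≫ h) (toFib p h ≫ φ.hom)
    (by rw [Category.assoc, Category.assoc, φ.w, reassoc_of% (toFib_fst p h)])

/-- Fibrewise maps over `h = (a, b) : T ⟶ B × B` are the maps over `B × B` from
`T ×_{B × B} π₁^* E` to `π₂^* E`. -/
def fibMapEquivOverMap {T : M} (h : T ⟶ B ⨯ B) :
    FibMap p (h ≫ prod.fst) (h ≫ prod.snd) ≃
      ((Over.map (srcFamily p)).obj ((Over.pullback (srcFamily p)).obj (Over.mk h)) ⟶
        Over.mk (tgtFamily p)) where
  toFun φ := Over.homMk (FibMap.toTgt p φ)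
    ((pullback.lift_fst _ _ _).trans pullback.condition)
  invFun u :=
    { hom := ofFib p h ≫ u.left ≫ pullback.snd (prod.snd : B ⨯ B ⟶ B) p
      w := by
        have h1 : u.left ≫ tgtFamily p = pullback.fst h (srcFamily p) ≫ h :=
          (Over.w u).trans pullback.condition.symm
        rw [Category.assoc, Category.assoc, ← pullback.condition, reassoc_of% h1,
          reassoc_of% (ofFib_fst p h)] }
  left_inv φ := by
    apply FibMap.ext
    change ofFib p h ≫ FibMap.toTgt p φ ≫ pullback.snd _ _ = _
    rw [FibMap.toTgt, pullback.lift_snd, reassoc_of% (ofFib_toFib p h)]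
  right_inv u := by
    have h1 : u.left ≫ tgtFamily p = pullback.fst h (srcFamily p) ≫ h :=
      (Over.w u).trans pullback.condition.symm
    apply Over.OverMorphism.ext
    apply pullback.hom_ext
    · exact (pullback.lift_fst _ _ _).trans h1.symm
    · refine (pullback.lift_snd _ _ _).trans ?_
      change toFib p h ≫ ofFib p h ≫ _ = _
      rw [reassoc_of% (toFib_ofFib p h)]

variable [(Over.pullback (srcFamily p)).IsLeftAdjoint]

/-- The object `Fun(p)` of fibrewise functions over `B × B`: the internal hom
`[π₁^* E, π₂^* E]` in the slice over `B × B`, i.e. the dependent product along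
`π₁^* E ⟶ B × B` of the pullback of `π₂^* E`. -/
def funOver : Over (B ⨯ B) :=
  (Functor.rightAdjoint (Over.pullback (srcFamily p))).obj
    ((Over.pullback (srcFamily p)).obj (Over.mk (tgtFamily p)))

/-- The universal property of `Fun(p)`: maps `T ⟶ Fun(p)` over `h = (a, b) : T ⟶ B × B`
correspond to maps `a^* E ⟶ b^* E` over `T`. -/
def funEquiv {T : M} (h : T ⟶ B ⨯ B) :
    FibMap p (h ≫ prod.fst) (h ≫ prod.snd) ≃ (Over.mk h ⟶ funOver p) :=
  (fibMapEquivOverMap p h).trans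
    (((Over.mapPullbackAdj (srcFamily p)).homEquiv _ _).trans
      ((Adjunction.ofIsLeftAdjoint (Over.pullback (srcFamily p))).homEquiv _ _))

/-- The total object of `Fun(p)`. -/
abbrev Fun : M := (funOver p).left

/-- The fibration `(s, t) : Fun(p) ⟶ B × B`. -/
abbrev funHom : Fun p ⟶ B ⨯ B := (funOver p).hom

/-- The source map. -/
def src : Fun p ⟶ B := funHom p ≫ prod.fst

/-- The target map. -/
def tgt : Fun p ⟶ B := funHom p ≫ prod.snd

/-- The universal fibrewise map `s^* E ⟶ t^* E` over `Fun(p)`. -/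
def ev : FibMap p (src p) (tgt p) := (funEquiv p (funHom p)).symm (𝟙 (funOver p))

variable {p}

/-- The map `T ⟶ Fun(p)` classifying a fibrewise map. -/
def classify {T : M} {a b : T ⟶ B} (φ : FibMap p a b) : T ⟶ Fun p :=
  (funEquiv p (prod.lift a b) (φ.reindex (𝟙 T) (by rw [Category.id_comp, prod.lift_fst])
    (by rw [Category.id_comp, prod.lift_snd]))).left

lemma classify_funHom {T : M} {a b : T ⟶ B} (φ : FibMap p a b) :
    classify φ ≫ funHom p = prod.lift a b :=
  Over.w (funEquiv p (prod.lift a b) (φ.reindex (𝟙 T) (by rw [Category.id_comp, prod.lift_fst])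
    (by rw [Category.id_comp, prod.lift_snd])))

lemma classify_src {T : M} {a b : T ⟶ B} (φ : FibMap p a b) : classify φ ≫ src p = a := by
  rw [src, reassoc_of% (classify_funHom φ), prod.lift_fst]

lemma classify_tgt {T : M} {a b : T ⟶ B} (φ : FibMap p a b) : classify φ ≫ tgt p = b := by
  rw [tgt, reassoc_of% (classify_funHom φ), prod.lift_snd]

lemma funEquiv_symm_eq {T : M} {h : T ⟶ B ⨯ B} (u : Over.mk h ⟶ funOver p) :
    (funEquiv p h).symm u = (ev p).reindex u.left
      (by rw [src, Over.w_assoc]; rfl) (by rw [tgt, Over.w_assoc]; rfl) := by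
  let adj := Adjunction.ofIsLeftAdjoint (Over.pullback (srcFamily p))
  let adj' := Over.mapPullbackAdj (srcFamily p)
  let w := (adj'.homEquiv _ _).symm ((adj.homEquiv (funOver p) _).symm (𝟙 (funOver p)))
  have h1 : (adj'.homEquiv _ _).symm ((adj.homEquiv _ _).symm u) =
      (Over.map (srcFamily p)).map ((Over.pullback (srcFamily p)).map u) ≫ w := by
    have e := adj.homEquiv_naturality_left_symm u (𝟙 (funOver p))
    refine Eq.trans (congrArg _ (Eq.trans (congrArg _ (Category.comp_id u).symm) e)) ?_
    exact adj'.homEquiv_naturality_left_symm _ _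
  apply FibMap.ext
  change ofFib p h ≫ ((adj'.homEquiv _ _).symm ((adj.homEquiv _ _).symm u)).left ≫
    pullback.snd _ _ = _ ≫ ofFib p (funHom p) ≫ w.left ≫ pullback.snd _ _
  rw [h1]
  let m : pullback h (srcFamily p) ⟶ pullback (funHom p) (srcFamily p) :=
    pullback.lift (pullback.fst h (srcFamily p) ≫ u.left) (pullback.snd _ _)
      (by rw [Category.assoc, Over.w]; exact pullback.condition)
  let k : pullback (h ≫ prod.fst) p ⟶ pullback (funHom p ≫ prod.fst) p :=
    pullback.lift (pullback.fst _ _ ≫ u.left) (pullback.snd _ _)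
      (by rw [Category.assoc, Over.w_assoc]; exact pullback.condition)
  have key : ofFib p h ≫ m = k ≫ ofFib p (funHom p) := by
    apply pullback.hom_ext
    · rw [Category.assoc, pullback.lift_fst, reassoc_of% (ofFib_fst p h), Category.assoc, ofFib_fst,
        pullback.lift_fst]
    · rw [Category.assoc, pullback.lift_snd, ofFib, pullback.lift_snd, Category.assoc, ofFib,
        pullback.lift_snd]
      apply pullback.hom_ext
      · rw [pullback.lift_fst, Category.assoc, pullback.lift_fst, pullback.lift_fst_assoc,
          Category.assoc, Over.w]
        rfl
      · rw [pullback.lift_snd, Category.assoc, pullback.lift_snd, pullback.lift_snd]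
  change ofFib p h ≫ (m ≫ w.left) ≫ pullback.snd (prod.snd : B ⨯ B ⟶ B) p =
    k ≫ ofFib p (funHom p) ≫ w.left ≫ pullback.snd (prod.snd : B ⨯ B ⟶ B) p
  rw [Category.assoc, ← Category.assoc (ofFib p h), key, Category.assoc]

/-- The map classifying `φ` pulls the universal fibrewise map back to `φ`. -/
lemma reindex_classify {T : M} {a b : T ⟶ B} (φ : FibMap p a b) :
    (ev p).reindex (classify φ) (classify_src φ) (classify_tgt φ) = φ := by
  have h := funEquiv_symm_eq (funEquiv p (prod.lift a b) (φ.reindex (𝟙 T)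
    (by rw [Category.id_comp, prod.lift_fst]) (by rw [Category.id_comp, prod.lift_snd])))
  rw [Equiv.symm_apply_apply] at h
  have h' := congrArg (fun ψ => FibMap.reindex ψ (𝟙 T)
    (show 𝟙 T ≫ prod.lift a b ≫ prod.fst = a by rw [Category.id_comp, prod.lift_fst])
    (show 𝟙 T ≫ prod.lift a b ≫ prod.snd = b by rw [Category.id_comp, prod.lift_snd])) h
  simp only [FibMap.reindex_reindex, Category.id_comp] at h'
  refine h'.symm.trans ?_
  ext
  simp only [FibMap.reindex_hom]
  convert Category.id_comp φ.hom
  apply pullback.hom_ext <;> simp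

/-- Two maps into `Fun(p)` agree if they classify the same fibrewise map. -/
lemma fun_hom_ext {T : M} {a b : T ⟶ B} {u v : T ⟶ Fun p} (hu : u ≫ src p = a)
    (hu' : u ≫ tgt p = b) (hv : v ≫ src p = a) (hv' : v ≫ tgt p = b)
    (h : (ev p).reindex u hu hu' = (ev p).reindex v hv hv') : u = v := by
  have e : v ≫ funHom p = u ≫ funHom p := by
    apply prod.hom_ext
    · rw [Category.assoc, Category.assoc]
      exact hv.trans hu.symm
    · rw [Category.assoc, Category.assoc]
      exact hv'.trans hu'.symm
  obtain rfl : a = (u ≫ funHom p) ≫ prod.fst := hu.symm.trans (Category.assoc _ _ _).symm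
  obtain rfl : b = (u ≫ funHom p) ≫ prod.snd := hu'.symm.trans (Category.assoc _ _ _).symm
  let U : Over.mk (u ≫ funHom p) ⟶ funOver p := Over.homMk u
  let V : Over.mk (u ≫ funHom p) ⟶ funOver p := Over.homMk v e
  have : U = V := by
    apply (funEquiv p (u ≫ funHom p)).symm.injective
    rw [funEquiv_symm_eq, funEquiv_symm_eq]
    exact h
  exact congrArg (fun z => z.left) this

/-! ### The nerve of `p` in degrees at most two -/

variable (p)

/-- The degeneracy `s₀ : N(p)₀ = B ⟶ Fun(p) = N(p)₁` (the reflexivity map), classifying the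
identity. -/
def unit : B ⟶ Fun p := classify (FibMap.id (𝟙 B))

/-- `N(p)₂ = Fun(p) ×_B Fun(p)`, pairs `(f, g)` of composable fibrewise maps. The projections are
the outer faces `d₂` (the map `f`) and `d₀` (the map `g`). -/
abbrev Fun₂ : M := pullback (tgt p) (src p)

/-- The inner face `d₁ : N(p)₂ ⟶ N(p)₁`, taking `(f, g)` to the composite `g ∘ f`. -/
def mul : Fun₂ p ⟶ Fun p :=
  classify (((ev p).reindex (pullback.fst (tgt p) (src p)) rfl rfl).comp
    ((ev p).reindex (pullback.snd (tgt p) (src p)) pullback.condition.symm rfl))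

/-- The degenerate triangle `s₀ s₀ : N(p)₀ ⟶ N(p)₂`. -/
def unit₂ : B ⟶ Fun₂ p :=
  pullback.lift (unit p) (unit p) (by rw [unit, classify_tgt, classify_src])

lemma unit₂_mul : unit₂ p ≫ mul p = unit p := by
  have h1 : unit p ≫ src p = 𝟙 B := classify_src _
  have h2 : unit p ≫ tgt p = 𝟙 B := classify_tgt _
  refine fun_hom_ext (a := 𝟙 B) (b := 𝟙 B) ?_ ?_ h1 h2 ?_
  · rw [mul, Category.assoc, classify_src, unit₂, pullback.lift_fst_assoc, h1]
  · rw [mul, Category.assoc, classify_tgt, unit₂, pullback.lift_snd_assoc, h2]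
  · have hε : (ev p).reindex (unit p) h1 h2 = FibMap.id (𝟙 B) := reindex_classify _
    have hf : unit₂ p ≫ pullback.fst _ _ = unit p := pullback.lift_fst _ _ _
    have hs : unit₂ p ≫ pullback.snd _ _ = unit p := pullback.lift_snd _ _ _
    have hm : (ev p).reindex (mul p) (classify_src _) (classify_tgt _) = _ := reindex_classify _
    rw [← FibMap.reindex_reindex (ev p) (mul p) (classify_src _) (classify_tgt _) (unit₂ p)
      (by rw [reassoc_of% hf, h1]) (by rw [reassoc_of% hs, h2]), hm,
      FibMap.reindex_comp _ _ (unit₂ p) (by rw [reassoc_of% hf, h1])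
      (by rw [reassoc_of% hf, h2]) (by rw [reassoc_of% hs, h2]),
      FibMap.reindex_reindex, FibMap.reindex_reindex]
    simp only [hf, hs]
    rw [hε, FibMap.id_comp]

/-- `Δ^* N(p)₁`, the object of fibrewise endomaps: the pullback of `(s, t) : Fun(p) ⟶ B × B` along
the diagonal of `B`. -/
abbrev EndObj : M := pullback (diag B) (funHom p)

/-- The projection `Δ^* N(p)₁ ⟶ B`. -/
abbrev endBase : EndObj p ⟶ B := pullback.fst _ _

/-- The section of `Δ^* N(p)₁ ⟶ B` given by the identities. -/
def endUnit : B ⟶ EndObj p :=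
  pullback.lift (𝟙 B) (unit p) (by rw [unit, classify_funHom, Category.id_comp])

/-- `Δ^* N(p)₂`, triangles `(f, g)` for which the composite `g ∘ f` is an endomap: the pullback of
`d₁` along `Δ^* N(p)₁ ⟶ N(p)₁`. -/
abbrev EndObj₂ : M := pullback (pullback.snd (diag B) (funHom p)) (mul p)

/-- The map `Δ^* d₁`, taking `(f, g)` to the endomap `g ∘ f`. -/
abbrev endMul : EndObj₂ p ⟶ EndObj p := pullback.fst _ _

/-- The pair `(Δ^* d₁, Δ^* s)` taking `(f, g)`, with `f : E_x ⟶ E_y` and `g : E_y ⟶ E_x`, to the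
pair of endomaps `(g ∘ f, id)` of `E_x`. -/
def endPair : EndObj₂ p ⟶ pullback (endBase p) (endBase p) :=
  pullback.lift (endMul p) (endMul p ≫ endBase p ≫ endUnit p)
    (by
      have : endUnit p ≫ endBase p = 𝟙 B := pullback.lift_fst _ _ _
      rw [Category.assoc, Category.assoc, this, Category.comp_id])

end Fibrewise

/-! ### The object of equivalences, and univalence -/

section Univalence

variable [ModelCategory M]

instance [IsLogicalModelCategory M] {E B : M} (p : E ⟶ B) [Fibration p] :
    (Over.pullback (srcFamily p)).IsLeftAdjoint :=
  IsLogicalModelCategory.pullback_isLeftAdjoint _ inferInstance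

variable [IsLogicalModelCategory M] {E B : M} (p : E ⟶ B) [Fibration p]

/-- The path object `P_B(Δ^* N(p)₁)` of fibrewise endomaps over `B`, with its maps
`Δ^* N(p)₁ ⟶ P_B(Δ^* N(p)₁) ⟶ Δ^* N(p)₁ ×_B Δ^* N(p)₁`. -/
abbrev endPath := pathFactorization (endBase p)

/-- `Inv(p)`: triples `(f, g, γ)` with `f : E_x ⟶ E_y`, `g : E_y ⟶ E_x` and `γ` a path from
`g ∘ f` to the identity of `E_x`. -/
abbrev Inv : M := pullback (endPath p).p (endPair p)

/-- `(f, g, γ) ↦ f`, the family of left inverses. -/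
def linv : Inv p ⟶ Fun p := pullback.snd _ _ ≫ pullback.snd _ _ ≫ pullback.fst _ _

/-- `(f, g, γ) ↦ g`, the family of right inverses. -/
def rinv : Inv p ⟶ Fun p := pullback.snd _ _ ≫ pullback.snd _ _ ≫ pullback.snd _ _

/-- `Equiv(p) = Linv(p) ×_{Fun(p)} Rinv(p)`: fibrewise maps with a left inverse and a right
inverse. -/
abbrev EquivObj : M := pullback (linv p) (rinv p)

/-- The degeneracy lifted to `Inv(p)`: the identity, with itself as inverse and the constant
path. -/
def unitInv : B ⟶ Inv p :=
  pullback.lift (endUnit p ≫ (endPath p).i)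
    (pullback.lift (endUnit p) (unit₂ p) (by rw [endUnit, pullback.lift_snd, unit₂_mul]))
    (by
      have h : endUnit p ≫ endBase p = 𝟙 B := pullback.lift_fst _ _ _
      rw [Category.assoc, MorphismProperty.MapFactorizationData.fac]
      have h₂ : ∀ (k : B ⟶ EndObj₂ p), k ≫ endMul p = endUnit p →
          endUnit p ≫ pullback.diagonal (endBase p) = k ≫ endPair p := by
        intro k hk
        apply pullback.hom_ext
        · rw [Category.assoc, pullback.diagonal_fst, Category.comp_id, Category.assoc, endPair,
            pullback.lift_fst, hk]
        · rw [Category.assoc, pullback.diagonal_snd, Category.comp_id, Category.assoc, endPair,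
            pullback.lift_snd, reassoc_of% hk, reassoc_of% h]
      exact h₂ _ (pullback.lift_fst _ _ _))

/-- The lift `B ⟶ Equiv(p)` of the degeneracy `B ⟶ Fun(p)`. -/
def unitEquiv : B ⟶ EquivObj p :=
  pullback.lift (unitInv p) (unitInv p) (by
    rw [linv, rinv, unitInv, pullback.lift_snd_assoc, pullback.lift_snd_assoc,
      pullback.lift_snd_assoc, pullback.lift_snd_assoc, unit₂, pullback.lift_fst,
      pullback.lift_snd])

/-- A fibration `p : E ⟶ B` is univalent if the map `B ⟶ Equiv(p)` given by the identities is an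
equivalence. -/
def IsUnivalent : Prop := WeakEquivalence (unitEquiv p)

end Univalence

/-! ### Homotopy cartesian squares, small fibrations and univalent completions -/

section Completion

variable [ModelCategory M]

/-- A commutative square with fibration `p` on the right is homotopy cartesian if the comparison
map to the pullback is a weak equivalence. (In a logical model category, which is right proper,
this pullback is a homotopy pullback.) Here `t : X ⟶ E` is the top map,
`q : X ⟶ Y` the left map and `b : Y ⟶ B` the base map. -/
def IsHomotopyCartesian {X Y E B : M} (t : X ⟶ E) (q : X ⟶ Y) (p : E ⟶ B) [Fibration p]
    (b : Y ⟶ B) : Prop :=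
  ∃ w : q ≫ b = t ≫ p, WeakEquivalence (pullback.lift q t w : X ⟶ pullback b p)

/-- A fibration is `π`-small if it is a homotopy pullback of `π` along some map. -/
def IsSmall {U' U : M} (π : U' ⟶ U) [Fibration π] {E B : M} (p : E ⟶ B) : Prop :=
  ∃ (t : E ⟶ U') (b : B ⟶ U), IsHomotopyCartesian t p π b

/-- A homotopy cartesian square of fibrations is a BM-equivalence if its base map is
`(-1)`-connected; here `conn` is the class of `(-1)`-connected maps. -/
def IsBMEquivalence (conn : MorphismProperty M) {X Y E B : M} (t : X ⟶ E) (q : X ⟶ Y)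
    [Fibration q] (p : E ⟶ B) [Fibration p] (b : Y ⟶ B) : Prop :=
  IsHomotopyCartesian t q p b ∧ conn b

/-- The square `(t, ι)` from `p` to `u` is a univalent completion of `p`: it is a BM-equivalence
and `u` is a small univalent fibration between fibrant objects. -/
def IsUnivalentCompletion [IsLogicalModelCategory M] (conn : MorphismProperty M)
    {U' U : M} (π : U' ⟶ U) [Fibration π] {E B E' B' : M} (p : E ⟶ B) [Fibration p]
    (u : E' ⟶ B') [Fibration u] (t : E ⟶ E') (ι : B ⟶ B') : Prop :=
  IsFibrant B' ∧ IsBMEquivalence conn t p u ι ∧ IsSmall π u ∧ IsUnivalent u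

end Completion

end UnivalentCompletion

end

/-!
The substance is that the pullback `p' = m^*p` of a univalent fibration `p : E ⟶ B` along a
`(-1)`-truncated fibration `m : B' ⟶ B` is univalent (`isUnivalent_of_isPullback`); the remaining
clauses of the proposition follow from the given weak factorization system on bifibrant objects and
from pasting of pullbacks.

Let `TripleObj p` be the object of triples `f : E_a ⟶ E_b`, `g h : E_b ⟶ E_a`, a limit of copies of
`Fun(p)`. By the universal property of `Fun(p)`, its formation commutes strictly with base change:
`TripleObj p'` is the pullback of `TripleObj p` along `m × m` (`isPullback_tripleBaseChange`). The
object `Equiv(p)` adds to such a triple two paths in the chosen path object of fibrewise endomaps.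
Chosen path objects commute with base change only up to homotopy, but since `m` is a fibration, the
Frobenius property makes the pullback of the path object for `p` a path object for `p'`
(`exists_endPath_comparison`). So `Equiv(p')` is weakly equivalent to the pullback of `Equiv(p)`
along `m × m`; the two path fibrations are replaced one after the other
(`weakEquivalence_pathPairsMap_of_comparison`), using that weak equivalences between fibrations over
a fixed base are stable under arbitrary pullback.

The pullback of the diagonal of `B` along `m × m` is the kernel pair `B' ×_B B'`. As a logical model
category is right proper, univalence of `p` makes `B' ×_B B'` weakly equivalent to the pullback of
`Equiv(p)`, hence to `Equiv(p')`; and `m` being `(-1)`-truncated says that the diagonal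
`B' ⟶ B' ×_B B'` is a weak equivalence (`weakEquivalence_diagonal`). The composite is the unit
`B' ⟶ Equiv(p')`.
-/

noncomputable section

namespace UnivalentCompletion

variable {M : Type u} [Category.{v} M]

/-! ### Homotopical lemmas -/

section Homotopical

variable [ModelCategory M]

lemma fibration_of_isPullback {P X Y Z : M} {fst : P ⟶ X} {snd : P ⟶ Y} {f : X ⟶ Z} {g : Y ⟶ Z}
    (h : IsPullback fst snd f g) [hf : Fibration f] : Fibration snd := by
  rw [fibration_iff] at hf ⊢
  exact MorphismProperty.of_isPullback h hf

lemma trivialFibration_of_isPullback {P X Y Z : M} {fst : P ⟶ X} {snd : P ⟶ Y} {f : X ⟶ Z}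
    {g : Y ⟶ Z} (h : IsPullback fst snd f g) [Fibration f] [WeakEquivalence f] :
    WeakEquivalence snd :=
  ((mem_trivialFibrations_iff _).1
    (MorphismProperty.of_isPullback h (mem_trivialFibrations f))).2

/-- A logical model category is right proper: factor the weak equivalence as a trivial cofibration,
which is handled by the Frobenius property, followed by a trivial fibration. -/
lemma weakEquivalence_of_isPullback [IsLogicalModelCategory M] {P X Y Z : M} {fst : P ⟶ X}
    {snd : P ⟶ Y} {f : X ⟶ Z} {g : Y ⟶ Z} (h : IsPullback fst snd f g) [Fibration f]
    [WeakEquivalence g] : WeakEquivalence fst := by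
  let d := MorphismProperty.factorizationData (trivialCofibrations M) (fibrations M) g
  have : WeakEquivalence d.p := weakEquivalence_of_precomp_of_fac d.fac
  have hq := IsPullback.of_hasPullback f d.p
  let i' : P ⟶ pullback f d.p := pullback.lift fst (snd ≫ d.i) (by rw [Category.assoc, d.fac, h.w])
  have hi : IsPullback i' snd (pullback.snd f d.p) d.i :=
    IsPullback.of_right (by rw [pullback.lift_fst, d.fac]; exact h) (pullback.lift_snd _ _ _) hq
  have : WeakEquivalence i' := ((mem_trivialCofibrations_iff _).1
    (IsLogicalModelCategory.frobenius hi inferInstance d.hi)).2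
  have := trivialFibration_of_isPullback hq.flip
  rw [← show i' ≫ pullback.fst f d.p = fst from pullback.lift_fst _ _ _]
  infer_instance

/-- A weak equivalence between fibrations over `Z` stays one after pullback along an arbitrary
map `a : A ⟶ Z`. This is Ken Brown's argument in the slice over `Z`: the map factors as a section
of a trivial fibration followed by a trivial fibration. -/
lemma weakEquivalence_of_isPullback_of_fibration {A X Y Z X' Y' : M} {a : A ⟶ Z} {x : X ⟶ Z}
    {y : Y ⟶ Z} [Fibration x] [Fibration y] {f : X ⟶ Y} [WeakEquivalence f] (hf : f ≫ y = x)
    {fstX : X' ⟶ A} {sndX : X' ⟶ X} (hX : IsPullback fstX sndX a x)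
    {fstY : Y' ⟶ A} {sndY : Y' ⟶ Y} (hY : IsPullback fstY sndY a y)
    {f' : X' ⟶ Y'} (h₁ : f' ≫ fstY = fstX) (h₂ : f' ≫ sndY = sndX ≫ f) :
    WeakEquivalence f' := by
  let d := MorphismProperty.factorizationData (trivialCofibrations M) (fibrations M)
    (pullback.lift (𝟙 X) f (by rw [hf, Category.id_comp]) : X ⟶ pullback x y)
  let q₁ : d.Z ⟶ X := d.p ≫ pullback.fst x y
  let q₂ : d.Z ⟶ Y := d.p ≫ pullback.snd x y
  have hj₁ : d.i ≫ q₁ = 𝟙 X := by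
    rw [MorphismProperty.MapFactorizationData.fac_assoc, pullback.lift_fst]
  have hj₂ : d.i ≫ q₂ = f := by
    rw [MorphismProperty.MapFactorizationData.fac_assoc, pullback.lift_snd]
  have hq : q₂ ≫ y = q₁ ≫ x := by rw [Category.assoc, Category.assoc, pullback.condition]
  have : WeakEquivalence q₁ := weakEquivalence_of_precomp_of_fac hj₁
  have : WeakEquivalence q₂ := weakEquivalence_of_precomp_of_fac hj₂
  have hW := IsPullback.of_hasPullback a (q₁ ≫ x)
  let q₁' := hX.lift (pullback.fst a (q₁ ≫ x)) (pullback.snd a (q₁ ≫ x) ≫ q₁)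
    (hW.w.trans (Category.assoc _ _ _).symm)
  let q₂' := hY.lift (pullback.fst a (q₁ ≫ x)) (pullback.snd a (q₁ ≫ x) ≫ q₂)
    (hW.w.trans ((congrArg (_ ≫ ·) hq.symm).trans (Category.assoc _ _ _).symm))
  have hq₁ : IsPullback q₁' (pullback.snd a (q₁ ≫ x)) sndX q₁ :=
    IsPullback.of_right (by rw [hX.lift_fst]; exact hW) (hX.lift_snd _ _ _) hX
  have hq₂ : IsPullback q₂' (pullback.snd a (q₁ ≫ x)) sndY q₂ :=
    IsPullback.of_right (by rw [hY.lift_fst, hq]; exact hW) (hY.lift_snd _ _ _) hY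
  have := trivialFibration_of_isPullback hq₁.flip
  have := trivialFibration_of_isPullback hq₂.flip
  let j' := hW.lift fstX (sndX ≫ d.i)
    (by rw [hX.w, Category.assoc, reassoc_of% hj₁])
  have hj₁' : j' ≫ q₁' = 𝟙 X' := by
    apply hX.hom_ext <;> simp [j', q₁', hj₁]
  have hj₂' : j' ≫ q₂' = f' := by
    apply hY.hom_ext <;> simp [j', q₂', hj₂, h₁, h₂]
  have : WeakEquivalence j' := weakEquivalence_of_postcomp_of_fac hj₁'
  rw [← hj₂']
  infer_instance

/-- For a `(-1)`-truncated fibration `m`, the section of the path object fibration exhibits the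
first projection of the kernel pair as a retract of a trivial fibration; hence the diagonal is a
weak equivalence. -/
lemma weakEquivalence_diagonal {X Y : M} (m : X ⟶ Y) [Fibration m] (hm : IsTruncatedFibration m) :
    WeakEquivalence (pullback.diagonal m) := by
  obtain ⟨σ, hσ⟩ := hm
  let d := pathFactorization m
  have h₁ : d.i ≫ d.p ≫ pullback.fst m m = 𝟙 X := by
    rw [MorphismProperty.MapFactorizationData.fac_assoc, pullback.diagonal_fst]
  have hd : WeakEquivalence (d.p ≫ pullback.fst m m) := weakEquivalence_of_precomp_of_fac h₁
  have hr : RetractArrow (pullback.fst m m) (d.p ≫ pullback.fst m m) :=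
    { i := Arrow.homMk σ (𝟙 _) (by simp [d, reassoc_of% hσ])
      r := Arrow.homMk d.p (𝟙 _) (by simp)
      retract := by ext <;> simp [d, hσ] }
  have : WeakEquivalence (pullback.fst m m) := by
    rw [weakEquivalence_iff] at hd ⊢
    exact MorphismProperty.of_retract hr hd
  exact weakEquivalence_of_postcomp_of_fac (pullback.diagonal_fst m)

end Homotopical

/-! ### Pulling back a path fibration along a pair of maps -/

section PathPairs

variable [HasPullbacks M]

/-- For `x : P ⟶ Z` and `e₁ e₂ : Q ⟶ Z`, the pullback of `x × x` along `(e₁, e₂) : Q ⟶ Z × Z`,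
encoded as an iterated pullback. -/
abbrev PathPairs {Q Z P : M} (e₁ e₂ : Q ⟶ Z) (x : P ⟶ Z) : M :=
  pullback (pullback.fst e₁ x ≫ e₂) x

/-- The projection of `PathPairs e₁ e₂ x` to `Q`. -/
abbrev pathPairsBase {Q Z P : M} (e₁ e₂ : Q ⟶ Z) (x : P ⟶ Z) : PathPairs e₁ e₂ x ⟶ Q :=
  pullback.fst _ _ ≫ pullback.fst _ _

variable {Q Z P Q' Z' P' : M} {e₁ e₂ : Q ⟶ Z} {x : P ⟶ Z} {e₁' e₂' : Q' ⟶ Z'} {x' : P' ⟶ Z'}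

/-- The functoriality of `PathPairs`. -/
def pathPairsMap {κQ : Q' ⟶ Q} {κ : Z' ⟶ Z} {l : P' ⟶ P} (h₁ : e₁' ≫ κ = κQ ≫ e₁)
    (h₂ : e₂' ≫ κ = κQ ≫ e₂) (hl : x' ≫ κ = l ≫ x) :
    PathPairs e₁' e₂' x' ⟶ PathPairs e₁ e₂ x :=
  pullback.map _ _ _ _ (pullback.map _ _ _ _ κQ l κ h₁ hl) l κ
    (by rw [Category.assoc, h₂, pullback.lift_fst_assoc, Category.assoc]) hl

lemma pathPairsMap_base {κQ : Q' ⟶ Q} {κ : Z' ⟶ Z} {l : P' ⟶ P} (h₁ : e₁' ≫ κ = κQ ≫ e₁)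
    (h₂ : e₂' ≫ κ = κQ ≫ e₂) (hl : x' ≫ κ = l ≫ x) :
    pathPairsMap h₁ h₂ hl ≫ pathPairsBase e₁ e₂ x = pathPairsBase e₁' e₂' x' ≫ κQ := by
  rw [pathPairsMap, pullback.lift_fst_assoc, Category.assoc, pullback.lift_fst, Category.assoc]

/-- If `x` is unchanged, then `PathPairs` is pulled back along the map of base objects. -/
lemma isPullback_pathPairsMap {e₁' e₂' : Q' ⟶ Z} {κQ : Q' ⟶ Q}
    (h₁ : e₁' ≫ 𝟙 Z = κQ ≫ e₁) (h₂ : e₂' ≫ 𝟙 Z = κQ ≫ e₂) :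
    IsPullback (pathPairsMap h₁ h₂ (l := 𝟙 P) ((Category.comp_id x).trans (Category.id_comp x).symm))
      (pathPairsBase e₁' e₂' x) (pathPairsBase e₁ e₂ x) κQ := by
  obtain rfl : e₁' = κQ ≫ e₁ := (Category.comp_id _).symm.trans h₁
  obtain rfl : e₂' = κQ ≫ e₂ := (Category.comp_id _).symm.trans h₂
  have hx : x ≫ 𝟙 Z = 𝟙 P ≫ x := (Category.comp_id x).trans (Category.id_comp x).symm
  have hA : IsPullback (pullback.map _ _ _ _ κQ (𝟙 P) (𝟙 Z) h₁ hx) (pullback.fst (κQ ≫ e₁) x)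
      (pullback.fst e₁ x) κQ :=
    IsPullback.of_right
      (by rw [pullback.lift_snd, Category.comp_id]; exact (IsPullback.of_hasPullback _ _).flip)
      (pullback.lift_fst _ _ _) (IsPullback.of_hasPullback e₁ x).flip
  refine IsPullback.paste_vert (IsPullback.of_right ?_ (pullback.lift_fst _ _ _)
    (IsPullback.of_hasPullback (pullback.fst e₁ x ≫ e₂) x).flip) hA
  have e : pullback.map (κQ ≫ e₁) x e₁ x κQ (𝟙 P) (𝟙 Z) h₁ hx ≫ pullback.fst e₁ x ≫ e₂ =
      pullback.fst (κQ ≫ e₁) x ≫ κQ ≫ e₂ := by rw [pullback.lift_fst_assoc, Category.assoc]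
  rw [pathPairsMap, pullback.lift_snd, Category.comp_id, e]
  exact (IsPullback.of_hasPullback _ _).flip

end PathPairs

section PathPairsHomotopy

variable [ModelCategory M] {Q Z P Q' Z' P' : M} {e₁ e₂ : Q ⟶ Z} {x : P ⟶ Z} {e₁' e₂' : Q' ⟶ Z'}
  {x' : P' ⟶ Z'} [Fibration x] [Fibration x'] {κQ : Q' ⟶ Q} {κ : Z' ⟶ Z} {l : P' ⟶ P}

/-- If the fibration `x'` is equivalent to the pullback of the fibration `x` along `κ`, then for any
`a` the pullback of `x'` along `a` is equivalent to that of `x` along `a ≫ κ`. -/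
lemma weakEquivalence_of_isPullback_of_comparison (hl : x' ≫ κ = l ≫ x)
    [hc : WeakEquivalence (pullback.lift x' l hl)] {A X' Y' : M} {a : A ⟶ Z'}
    {fstX : X' ⟶ A} {sndX : X' ⟶ P'} (hX : IsPullback fstX sndX a x')
    {fstY : Y' ⟶ A} {sndY : Y' ⟶ P} (hY : IsPullback fstY sndY (a ≫ κ) x)
    {f' : X' ⟶ Y'} (h₁ : f' ≫ fstY = fstX) (h₂ : f' ≫ sndY = sndX ≫ l) :
    WeakEquivalence f' := by
  refine weakEquivalence_of_isPullback_of_fibration (pullback.lift_fst x' l hl) hX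
    (IsPullback.of_bot' hY (IsPullback.of_hasPullback κ x)) h₁ ?_
  apply pullback.hom_ext
  · simp [reassoc_of% h₁, hX.w, pullback.lift_fst]
  · simp [h₂, pullback.lift_snd]

/-- If the fibration `x'` is equivalent to the pullback of the fibration `x` along `κ`, then
`PathPairs e₁' e₂' x'` is equivalent to `PathPairs (e₁' ≫ κ) (e₂' ≫ κ) x`. -/
lemma weakEquivalence_pathPairsMap_of_comparison [IsLogicalModelCategory M]
    (hl : x' ≫ κ = l ≫ x) [WeakEquivalence (pullback.lift x' l hl)]
    (h₁ : e₁' ≫ κ = 𝟙 Q' ≫ e₁' ≫ κ) (h₂ : e₂' ≫ κ = 𝟙 Q' ≫ e₂' ≫ κ) :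
    WeakEquivalence (pathPairsMap h₁ h₂ hl) := by
  -- The two copies of the path fibration are replaced one at a time.
  let a := pullback.map e₁' x' (e₁' ≫ κ) x (𝟙 Q') l κ h₁ hl
  have ha : a ≫ pullback.fst (e₁' ≫ κ) x = pullback.fst e₁' x' :=
    (pullback.lift_fst _ _ _).trans (Category.comp_id _)
  have : WeakEquivalence a := weakEquivalence_of_isPullback_of_comparison hl
    (IsPullback.of_hasPullback e₁' x') (IsPullback.of_hasPullback (e₁' ≫ κ) x) ha
    (pullback.lift_snd _ _ _)
  have hb := IsPullback.of_hasPullback ((pullback.fst e₁' x' ≫ e₂') ≫ κ) x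
  have hc := IsPullback.of_hasPullback (pullback.fst (e₁' ≫ κ) x ≫ e₂' ≫ κ) x
  let b : PathPairs e₁' e₂' x' ⟶ pullback ((pullback.fst e₁' x' ≫ e₂') ≫ κ) x :=
    pullback.lift (pullback.fst _ _) (pullback.snd _ _ ≫ l)
      (by rw [Category.assoc _ l x, ← hl, pullback.condition_assoc])
  have : WeakEquivalence b := weakEquivalence_of_isPullback_of_comparison hl
    (IsPullback.of_hasPullback (pullback.fst e₁' x' ≫ e₂') x') hb
    (pullback.lift_fst _ _ _) (pullback.lift_snd _ _ _)
  have e : (pullback.fst e₁' x' ≫ e₂') ≫ κ = a ≫ pullback.fst (e₁' ≫ κ) x ≫ e₂' ≫ κ := by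
    rw [reassoc_of% ha, Category.assoc]
  let c : pullback ((pullback.fst e₁' x' ≫ e₂') ≫ κ) x ⟶ PathPairs (e₁' ≫ κ) (e₂' ≫ κ) x :=
    hc.lift (pullback.fst _ _ ≫ a) (pullback.snd _ _)
      ((Category.assoc _ _ _).trans ((congrArg (_ ≫ ·) e.symm).trans hb.w))
  have hca : IsPullback c (pullback.fst _ _) (pullback.fst _ _) a :=
    IsPullback.of_right (by rw [← e, hc.lift_snd]; exact hb.flip) (hc.lift_fst _ _ _) hc.flip
  have : WeakEquivalence c := weakEquivalence_of_isPullback hca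
  have hbc : b ≫ c = pathPairsMap h₁ h₂ hl := by
    apply pullback.hom_ext
    · rw [Category.assoc, hc.lift_fst, pullback.lift_fst_assoc, pathPairsMap, pullback.lift_fst]
    · rw [Category.assoc, hc.lift_snd, pullback.lift_snd, pathPairsMap, pullback.lift_snd]
  rw [← hbc]
  infer_instance

/-- Descent of "the unit is a weak equivalence" from `PathPairs e₁ e₂ x` to
`PathPairs e₁' e₂' x'`: here `S` is the pullback of the unit `V ⟶ Q` along a fibration
`κQ : Q' ⟶ Q`, the object `B'` is weakly equivalent to `S`, and `x'` is equivalent to the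
pullback of `x` along `κ`. -/
lemma weakEquivalence_unit_pathPairs [IsLogicalModelCategory M] [Fibration κQ]
    (h₁ : e₁' ≫ κ = κQ ≫ e₁) (h₂ : e₂' ≫ κ = κQ ≫ e₂) (hl : x' ≫ κ = l ≫ x)
    [WeakEquivalence (pullback.lift x' l hl)] {V S B' : M} {s : V ⟶ PathPairs e₁ e₂ x}
    [WeakEquivalence s] {top : S ⟶ V} {left : S ⟶ Q'}
    (hS : IsPullback top left (s ≫ pathPairsBase e₁ e₂ x) κQ) {δ : B' ⟶ S} [WeakEquivalence δ]
    {s' : B' ⟶ PathPairs e₁' e₂' x'} (hs : s' ≫ pathPairsMap h₁ h₂ hl = δ ≫ top ≫ s)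
    (hs' : s' ≫ pathPairsBase e₁' e₂' x' = δ ≫ left) : WeakEquivalence s' := by
  have hid (e : Q' ⟶ Z') : e ≫ κ = 𝟙 Q' ≫ e ≫ κ := (Category.id_comp _).symm
  let φ := pathPairsMap (hid e₁') (hid e₂') hl
  have : WeakEquivalence φ := weakEquivalence_pathPairsMap_of_comparison hl _ _
  have hD := isPullback_pathPairsMap (x := x) ((Category.comp_id _).trans h₁)
    ((Category.comp_id _).trans h₂)
  have := fibration_of_isPullback hD.flip
  let σ := hD.lift (top ≫ s) left (by rw [Category.assoc, hS.w])
  have hσ : IsPullback σ top (pathPairsMap ((Category.comp_id _).trans h₁)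
    ((Category.comp_id _).trans h₂) _) s :=
    IsPullback.of_right (by rw [hD.lift_snd]; exact hS.flip) (hD.lift_fst _ _ _) hD.flip
  have : WeakEquivalence σ := weakEquivalence_of_isPullback hσ
  refine weakEquivalence_of_postcomp_of_fac (g := φ) (fg := δ ≫ σ) (hD.hom_ext ?_ ?_)
  · refine (Category.assoc _ _ _).trans (Eq.trans ?_
      ((congrArg (δ ≫ ·) (hD.lift_fst _ _ _)).symm.trans (Category.assoc _ _ _).symm))
    rw [← hs]
    congr 1
    apply pullback.hom_ext
    · apply pullback.hom_ext <;> simp [φ, pathPairsMap, pullback.map, pullback.lift_fst,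
        pullback.lift_snd, pullback.lift_fst_assoc]
    · simp [φ, pathPairsMap, pullback.map, pullback.lift_snd]
  · rw [Category.assoc, Category.assoc, hD.lift_snd, ← hs', pathPairsMap_base, Category.comp_id]

end PathPairsHomotopy

/-! ### Base change of fibrewise maps -/

section BaseChange

variable [HasPullbacks M] {E B E' B' : M} {p : E ⟶ B} {p' : E' ⟶ B'} {k : E' ⟶ E} {m : B' ⟶ B}

/-- If `E' = m^*E`, the comparison `(m ∘ a)^*E ⟶ a^*E'`. -/
def toFibre (h : IsPullback k p' p m) {T : M} (a : T ⟶ B') : pullback (a ≫ m) p ⟶ pullback a p' :=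
  pullback.lift (pullback.fst _ _)
    (h.lift (pullback.snd _ _) (pullback.fst _ _ ≫ a)
      (by rw [← pullback.condition, Category.assoc]))
    (h.lift_snd _ _ _).symm

/-- If `E' = m^*E`, the comparison `a^*E' ⟶ (m ∘ a)^*E`. -/
def ofFibre (h : IsPullback k p' p m) {T : M} (a : T ⟶ B') : pullback a p' ⟶ pullback (a ≫ m) p :=
  pullback.lift (pullback.fst _ _) (pullback.snd _ _ ≫ k)
    (by rw [Category.assoc, h.w, pullback.condition_assoc])

variable (h : IsPullback k p' p m)

lemma toFibre_fst {T : M} (a : T ⟶ B') :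
    toFibre h a ≫ pullback.fst _ _ = pullback.fst _ _ := pullback.lift_fst _ _ _

lemma toFibre_snd {T : M} (a : T ⟶ B') :
    toFibre h a ≫ pullback.snd _ _ ≫ k = pullback.snd _ _ := by
  rw [toFibre, pullback.lift_snd_assoc, h.lift_fst]

lemma ofFibre_fst {T : M} (a : T ⟶ B') :
    ofFibre h a ≫ pullback.fst _ _ = pullback.fst _ _ := pullback.lift_fst _ _ _

lemma ofFibre_snd {T : M} (a : T ⟶ B') :
    ofFibre h a ≫ pullback.snd _ _ = pullback.snd _ _ ≫ k := pullback.lift_snd _ _ _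

lemma toFibre_ofFibre {T : M} (a : T ⟶ B') : toFibre h a ≫ ofFibre h a = 𝟙 _ := by
  apply pullback.hom_ext
  · rw [Category.assoc, ofFibre_fst, toFibre_fst, Category.id_comp]
  · rw [Category.assoc, ofFibre_snd, toFibre_snd, Category.id_comp]

include h in
lemma fibre_hom_ext {T S : M} {a : T ⟶ B'} {u v : S ⟶ pullback a p'}
    (h₁ : u ≫ pullback.fst _ _ = v ≫ pullback.fst _ _)
    (h₂ : u ≫ pullback.snd _ _ ≫ k = v ≫ pullback.snd _ _ ≫ k) : u = v := by
  apply pullback.hom_ext h₁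
  apply h.hom_ext
  · rwa [Category.assoc, Category.assoc]
  · rw [Category.assoc, Category.assoc, ← pullback.condition, reassoc_of% h₁]

lemma ofFibre_toFibre {T : M} (a : T ⟶ B') : ofFibre h a ≫ toFibre h a = 𝟙 _ := by
  apply fibre_hom_ext h
  · rw [Category.assoc, toFibre_fst, ofFibre_fst, Category.id_comp]
  · rw [Category.assoc, toFibre_snd, ofFibre_snd, Category.id_comp]

namespace FibMap

/-- Maps `a^*E' ⟶ b^*E'` for `E' = m^*E` regarded as maps `(m ∘ a)^*E ⟶ (m ∘ b)^*E`. -/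
def push {T : M} {a b : T ⟶ B'} (φ : FibMap p' a b) : FibMap p (a ≫ m) (b ≫ m) where
  hom := toFibre h a ≫ φ.hom ≫ k
  w := by rw [Category.assoc, Category.assoc, h.w, reassoc_of% φ.w,
    reassoc_of% (toFibre_fst h a)]

/-- The inverse of `FibMap.push`. -/
def pull {T : M} {a b : T ⟶ B'} (φ : FibMap p (a ≫ m) (b ≫ m)) : FibMap p' a b where
  hom := h.lift (ofFibre h a ≫ φ.hom) (pullback.fst _ _ ≫ b)
    (by rw [Category.assoc, φ.w, reassoc_of% (ofFibre_fst h a), Category.assoc])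
  w := h.lift_snd _ _ _

lemma push_pull {T : M} {a b : T ⟶ B'} (φ : FibMap p (a ≫ m) (b ≫ m)) :
    (φ.pull h).push h = φ := by
  ext
  change toFibre h a ≫ h.lift _ _ _ ≫ k = _
  rw [h.lift_fst, reassoc_of% (toFibre_ofFibre h a)]

lemma push_injective {T : M} {a b : T ⟶ B'} :
    Function.Injective (push h : FibMap p' a b → FibMap p (a ≫ m) (b ≫ m)) := by
  intro φ ψ e
  have e' : toFibre h a ≫ φ.hom ≫ k = toFibre h a ≫ ψ.hom ≫ k := congrArg FibMap.hom e
  ext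
  apply h.hom_ext
  · have := congrArg (ofFibre h a ≫ ·) e'
    simpa only [← Category.assoc, ofFibre_toFibre, Category.id_comp] using this
  · rw [φ.w, ψ.w]

lemma push_id {T : M} (a : T ⟶ B') : (FibMap.id (p := p') a).push h = FibMap.id (a ≫ m) := by
  ext
  exact toFibre_snd h a

lemma push_comp {T : M} {a b c : T ⟶ B'} (φ : FibMap p' a b) (ψ : FibMap p' b c) :
    (φ.comp ψ).push h = (φ.push h).comp (ψ.push h) := by
  ext
  simp only [push, comp_hom, ← Category.assoc]
  congr 2
  apply fibre_hom_ext h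
  · simp only [Category.assoc, toFibre_fst, pullback.lift_fst]
  · simp only [Category.assoc, toFibre_snd, pullback.lift_snd, pullback.lift_snd_assoc]

lemma push_reindex {T T' : M} {a b : T ⟶ B'} {a' b' : T' ⟶ B'} (φ : FibMap p' a b) (u : T' ⟶ T)
    (ha : u ≫ a = a') (hb : u ≫ b = b') :
    (φ.reindex u ha hb).push h = (φ.push h).reindex u (by rw [← ha, Category.assoc])
      (by rw [← hb, Category.assoc]) := by
  ext
  simp only [push, reindex_hom, ← Category.assoc]
  congr 2
  apply fibre_hom_ext h
  · simp only [Category.assoc, toFibre_fst, pullback.lift_fst]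
    rw [reassoc_of% (toFibre_fst h a')]
  · simp only [Category.assoc, toFibre_snd, pullback.lift_snd, pullback.lift_snd_assoc]

end FibMap

variable [HasBinaryProducts M] [(Over.pullback (srcFamily p)).IsLeftAdjoint]
  [(Over.pullback (srcFamily p')).IsLeftAdjoint]

/-- The map `Fun(m^*p) ⟶ Fun(p)`. -/
def funBaseChange : Fun p' ⟶ Fun p := classify ((ev p').push h)

lemma funBaseChange_src : funBaseChange h ≫ src p = src p' ≫ m := classify_src _

lemma funBaseChange_tgt : funBaseChange h ≫ tgt p = tgt p' ≫ m := classify_tgt _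

lemma comp_funBaseChange_src {T : M} {a : T ⟶ B'} {u : T ⟶ Fun p'} (ha : u ≫ src p' = a) :
    (u ≫ funBaseChange h) ≫ src p = a ≫ m := by
  rw [Category.assoc, funBaseChange_src, reassoc_of% ha]

lemma comp_funBaseChange_tgt {T : M} {a : T ⟶ B'} {u : T ⟶ Fun p'} (ha : u ≫ tgt p' = a) :
    (u ≫ funBaseChange h) ≫ tgt p = a ≫ m := by
  rw [Category.assoc, funBaseChange_tgt, reassoc_of% ha]

/-- Composition with `Fun(m^*p) ⟶ Fun(p)` corresponds to `FibMap.push` on fibrewise maps. -/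
lemma reindex_funBaseChange {T : M} {a b : T ⟶ B'} (u : T ⟶ Fun p') (ha : u ≫ src p' = a)
    (hb : u ≫ tgt p' = b) :
    (ev p).reindex (u ≫ funBaseChange h) (comp_funBaseChange_src h ha)
      (comp_funBaseChange_tgt h hb) = ((ev p').reindex u ha hb).push h := by
  rw [FibMap.push_reindex, ← FibMap.reindex_reindex (ev p) (funBaseChange h)
    (funBaseChange_src h) (funBaseChange_tgt h) u (by rw [reassoc_of% ha])
    (by rw [reassoc_of% hb])]
  congr 1
  exact reindex_classify _

/-- Maps into `Fun(m^*p)` agree if they agree after composition to `B'`, `B'` and `Fun(p)`. -/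
lemma fun_hom_ext_of_funBaseChange {T : M} {u v : T ⟶ Fun p'} (hs : u ≫ src p' = v ≫ src p')
    (ht : u ≫ tgt p' = v ≫ tgt p') (e : u ≫ funBaseChange h = v ≫ funBaseChange h) : u = v := by
  refine fun_hom_ext (a := v ≫ src p') (b := v ≫ tgt p') hs ht rfl rfl (FibMap.push_injective h ?_)
  rw [← reindex_funBaseChange, ← reindex_funBaseChange]
  simp only [e]

/-- With `fun_hom_ext_of_funBaseChange`, this says that `Fun(m^*p)` is the pullback of `Fun(p)`
along `m × m`. -/
lemma exists_lift_funBaseChange {T : M} (a b : T ⟶ B') (y : T ⟶ Fun p)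
    (ha : y ≫ src p = a ≫ m) (hb : y ≫ tgt p = b ≫ m) :
    ∃ u : T ⟶ Fun p', u ≫ src p' = a ∧ u ≫ tgt p' = b ∧ u ≫ funBaseChange h = y := by
  let φ := ((ev p).reindex y ha hb).pull h
  refine ⟨classify φ, classify_src _, classify_tgt _, ?_⟩
  refine fun_hom_ext (comp_funBaseChange_src h (classify_src _))
    (comp_funBaseChange_tgt h (classify_tgt _)) ha hb ?_
  rw [reindex_funBaseChange h _ (classify_src _) (classify_tgt _), reindex_classify, FibMap.push_pull]

lemma unit_src : unit p ≫ src p = 𝟙 B := classify_src _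

lemma unit_tgt : unit p ≫ tgt p = 𝟙 B := classify_tgt _

lemma unit_funBaseChange : unit p' ≫ funBaseChange h = m ≫ unit p := by
  have e : m ≫ 𝟙 B = 𝟙 B' ≫ m := by rw [Category.id_comp, Category.comp_id]
  refine fun_hom_ext (comp_funBaseChange_src h unit_src) (comp_funBaseChange_tgt h unit_tgt)
    (by rw [Category.assoc, unit_src, e]) (by rw [Category.assoc, unit_tgt, e]) ?_
  have h₁ : (ev p').reindex (unit p') unit_src unit_tgt = FibMap.id (𝟙 B') := reindex_classify _
  have h₂ : (ev p).reindex (unit p) unit_src unit_tgt = FibMap.id (𝟙 B) := reindex_classify _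
  rw [reindex_funBaseChange h _ unit_src unit_tgt, h₁, FibMap.push_id,
    ← FibMap.reindex_reindex (ev p) (unit p) unit_src unit_tgt m e e, h₂, FibMap.reindex_id]

lemma mul_src : mul p ≫ src p = pullback.fst _ _ ≫ src p := classify_src _

lemma mul_tgt : mul p ≫ tgt p = pullback.snd _ _ ≫ tgt p := classify_tgt _

/-- The map `Fun(m^*p) ×_{B'} Fun(m^*p) ⟶ Fun(p) ×_B Fun(p)`. -/
abbrev fun₂BaseChange : Fun₂ p' ⟶ Fun₂ p :=
  pullback.map _ _ _ _ (funBaseChange h) (funBaseChange h) m (funBaseChange_tgt h).symm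
    (funBaseChange_src h).symm

lemma mul_funBaseChange : mul p' ≫ funBaseChange h = fun₂BaseChange h ≫ mul p := by
  have hf : fun₂BaseChange h ≫ pullback.fst _ _ = pullback.fst _ _ ≫ funBaseChange h :=
    pullback.lift_fst _ _ _
  have hg : fun₂BaseChange h ≫ pullback.snd _ _ = pullback.snd _ _ ≫ funBaseChange h :=
    pullback.lift_snd _ _ _
  refine fun_hom_ext (comp_funBaseChange_src h mul_src)
    (comp_funBaseChange_tgt h mul_tgt)
    (by rw [Category.assoc, mul_src, reassoc_of% hf, funBaseChange_src, Category.assoc])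
    (by rw [Category.assoc, mul_tgt, reassoc_of% hg, funBaseChange_tgt, Category.assoc]) ?_
  have h₁ : (ev p').reindex (mul p') mul_src mul_tgt = _ := reindex_classify _
  have h₂ : (ev p).reindex (mul p) mul_src mul_tgt = _ := reindex_classify _
  rw [reindex_funBaseChange h _ mul_src mul_tgt, h₁, FibMap.push_comp, ← reindex_funBaseChange,
    ← reindex_funBaseChange, ← FibMap.reindex_reindex (ev p) (mul p) mul_src
      mul_tgt (fun₂BaseChange h)
      (by rw [reassoc_of% hf, funBaseChange_src, Category.assoc])
      (by rw [reassoc_of% hg, funBaseChange_tgt, Category.assoc]), h₂,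
    FibMap.reindex_comp _ _ (fun₂BaseChange h)
      (by rw [reassoc_of% hf, funBaseChange_src, Category.assoc])
      (b' := (pullback.fst _ _ ≫ tgt p') ≫ m)
      (by rw [reassoc_of% hf, funBaseChange_tgt, Category.assoc])
      (by rw [reassoc_of% hg, funBaseChange_tgt, Category.assoc]),
    FibMap.reindex_reindex, FibMap.reindex_reindex]
  simp only [hf, hg]

end BaseChange

/-! ### Invertibility data and its base change -/

section InvertibilityData

variable [HasPullbacks M] {E B E' B' : M} {p : E ⟶ B} {p' : E' ⟶ B'} {k : E' ⟶ E} {m : B' ⟶ B}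
  [HasBinaryProducts M] [(Over.pullback (srcFamily p)).IsLeftAdjoint]
  [(Over.pullback (srcFamily p')).IsLeftAdjoint]

variable (p) in
/-- The map `(f, g) ↦ f` on pairs `f : E_a ⟶ E_b`, `g : E_b ⟶ E_a`. -/
def forth : EndObj₂ p ⟶ Fun p := pullback.snd _ _ ≫ pullback.fst _ _

variable (p) in
/-- The map `(f, g) ↦ g` on pairs `f : E_a ⟶ E_b`, `g : E_b ⟶ E_a`. -/
def back : EndObj₂ p ⟶ Fun p := pullback.snd _ _ ≫ pullback.snd _ _

lemma end_src : pullback.snd (diag B) (funHom p) ≫ src p = endBase p := by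
  rw [src, ← pullback.condition_assoc, prod.lift_fst, Category.comp_id]

lemma end_tgt : pullback.snd (diag B) (funHom p) ≫ tgt p = endBase p := by
  rw [tgt, ← pullback.condition_assoc, prod.lift_snd, Category.comp_id]

lemma back_src : back p ≫ src p = forth p ≫ tgt p := by
  rw [forth, back, Category.assoc, Category.assoc, pullback.condition]

lemma back_tgt : back p ≫ tgt p = forth p ≫ src p := by
  rw [forth, back, Category.assoc, Category.assoc, ← mul_src, ← mul_tgt, ← pullback.condition_assoc,
    ← pullback.condition_assoc, end_src, end_tgt]

lemma end₂_hom_ext {T : M} {u v : T ⟶ EndObj₂ p} (h₁ : u ≫ forth p = v ≫ forth p)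
    (h₂ : u ≫ back p = v ≫ back p) : u = v := by
  have e : u ≫ pullback.snd _ _ = v ≫ pullback.snd _ _ :=
    pullback.hom_ext (by simpa only [Category.assoc, forth] using h₁)
      (by simpa only [Category.assoc, back] using h₂)
  have e' : u ≫ endMul p ≫ pullback.snd _ _ = v ≫ endMul p ≫ pullback.snd _ _ := by
    rw [pullback.condition, reassoc_of% e]
  refine pullback.hom_ext (pullback.hom_ext ?_ ?_) e
  · change (u ≫ endMul p) ≫ endBase p = (v ≫ endMul p) ≫ endBase p
    rw [← end_src, Category.assoc, Category.assoc, reassoc_of% e']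
  · simpa only [Category.assoc] using e'

lemma end₂_exists_lift {T : M} (f g : T ⟶ Fun p) (h₁ : f ≫ tgt p = g ≫ src p)
    (h₂ : g ≫ tgt p = f ≫ src p) : ∃ u : T ⟶ EndObj₂ p, u ≫ forth p = f ∧ u ≫ back p = g := by
  let w : T ⟶ Fun₂ p := pullback.lift f g h₁
  have hs : (w ≫ mul p) ≫ src p = f ≫ src p := by
    rw [Category.assoc, mul_src, pullback.lift_fst_assoc]
  have ht : (w ≫ mul p) ≫ tgt p = f ≫ src p := by
    rw [Category.assoc, mul_tgt, pullback.lift_snd_assoc, h₂]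
  let l : T ⟶ EndObj p := pullback.lift (f ≫ src p) (w ≫ mul p) (by
    apply prod.hom_ext
    · rw [Category.assoc, prod.lift_fst, Category.comp_id, Category.assoc]
      exact hs.symm
    · rw [Category.assoc, prod.lift_snd, Category.comp_id, Category.assoc]
      exact ht.symm)
  refine ⟨pullback.lift l w (pullback.lift_snd _ _ _), ?_, ?_⟩
  · rw [forth, pullback.lift_snd_assoc, pullback.lift_fst]
  · rw [back, pullback.lift_snd_assoc, pullback.lift_snd]

variable (p) in
/-- The object of triples consisting of `f : E_a ⟶ E_b` and `g h : E_b ⟶ E_a`, without any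
homotopies, encoded by the pairs `(f, g)` and `(h, f)`. -/
abbrev TripleObj : M := pullback (forth p) (back p)

variable (p) in
/-- The map `(f, g, h) ↦ f`. -/
def tripleF : TripleObj p ⟶ Fun p := pullback.fst _ _ ≫ forth p

variable (p) in
/-- The map `(f, g, h) ↦ g`. -/
def tripleG : TripleObj p ⟶ Fun p := pullback.fst _ _ ≫ back p

variable (p) in
/-- The map `(f, g, h) ↦ h`. -/
def tripleH : TripleObj p ⟶ Fun p := pullback.snd _ _ ≫ forth p

variable (p) in
/-- The map `(f, g, h) ↦ (a, b)` for `f : E_a ⟶ E_b`. -/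
def tripleBase : TripleObj p ⟶ B ⨯ B := tripleF p ≫ funHom p

lemma tripleG_src : tripleG p ≫ src p = tripleF p ≫ tgt p := by
  rw [tripleG, tripleF, Category.assoc, Category.assoc, back_src]

lemma tripleG_tgt : tripleG p ≫ tgt p = tripleF p ≫ src p := by
  rw [tripleG, tripleF, Category.assoc, Category.assoc, back_tgt]

lemma tripleH_src : tripleH p ≫ src p = tripleF p ≫ tgt p := by
  rw [tripleH, tripleF, pullback.condition, Category.assoc, Category.assoc, back_tgt]

lemma tripleH_tgt : tripleH p ≫ tgt p = tripleF p ≫ src p := by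
  rw [tripleH, tripleF, pullback.condition, Category.assoc, Category.assoc, back_src]

lemma triple_hom_ext {T : M} {u v : T ⟶ TripleObj p} (hf : u ≫ tripleF p = v ≫ tripleF p)
    (hg : u ≫ tripleG p = v ≫ tripleG p) (hh : u ≫ tripleH p = v ≫ tripleH p) : u = v := by
  refine pullback.hom_ext (end₂_hom_ext ?_ ?_) (end₂_hom_ext ?_ ?_)
  · simpa only [Category.assoc, tripleF] using hf
  · simpa only [Category.assoc, tripleG] using hg
  · simpa only [Category.assoc, tripleH] using hh
  · simpa only [Category.assoc, tripleF, pullback.condition] using hf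

lemma triple_exists_lift {T : M} (f g k : T ⟶ Fun p) (hg : g ≫ src p = f ≫ tgt p)
    (hg' : g ≫ tgt p = f ≫ src p) (hk : k ≫ src p = f ≫ tgt p) (hk' : k ≫ tgt p = f ≫ src p) :
    ∃ u : T ⟶ TripleObj p, u ≫ tripleF p = f ∧ u ≫ tripleG p = g ∧ u ≫ tripleH p = k := by
  obtain ⟨u, hu, hu'⟩ := end₂_exists_lift f g hg.symm hg'
  obtain ⟨v, hv, hv'⟩ := end₂_exists_lift k f hk' hk.symm
  exact ⟨pullback.lift u v (hu.trans hv'.symm), by rw [tripleF, pullback.lift_fst_assoc, hu],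
    by rw [tripleG, pullback.lift_fst_assoc, hu'], by rw [tripleH, pullback.lift_snd_assoc, hv]⟩

variable (p) in
/-- The family of pairs `(id, id)` of identities of the fibres of `p`. -/
def unitEnd₂ : B ⟶ EndObj₂ p :=
  pullback.lift (endUnit p) (unit₂ p) (by rw [endUnit, pullback.lift_snd, unit₂_mul])

lemma unitEnd₂_forth : unitEnd₂ p ≫ forth p = unit p := by
  rw [forth, unitEnd₂, pullback.lift_snd_assoc, unit₂, pullback.lift_fst]

lemma unitEnd₂_back : unitEnd₂ p ≫ back p = unit p := by
  rw [back, unitEnd₂, pullback.lift_snd_assoc, unit₂, pullback.lift_snd]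

variable (p) in
/-- The triple of identities. -/
def unitTriple : B ⟶ TripleObj p :=
  pullback.lift (unitEnd₂ p) (unitEnd₂ p) (by rw [unitEnd₂_forth, unitEnd₂_back])

lemma unitTriple_base : unitTriple p ≫ tripleBase p = diag B := by
  rw [tripleBase, tripleF, Category.assoc, unitTriple, pullback.lift_fst_assoc,
    reassoc_of% (unitEnd₂_forth (p := p)), unit, classify_funHom]

variable (h : IsPullback k p' p m)

lemma funBaseChange_funHom : funHom p' ≫ prod.map m m = funBaseChange h ≫ funHom p := by
  apply prod.hom_ext
  · rw [Category.assoc, Category.assoc, prod.map_fst]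
    exact (Category.assoc _ _ _).symm.trans (funBaseChange_src h).symm
  · rw [Category.assoc, Category.assoc, prod.map_snd]
    exact (Category.assoc _ _ _).symm.trans (funBaseChange_tgt h).symm

/-- The base change map on fibrewise endomaps. -/
abbrev endBaseChange : EndObj p' ⟶ EndObj p :=
  pullback.map _ _ _ _ m (funBaseChange h) (prod.map m m) (by simp) (funBaseChange_funHom h)

/-- The formation of the object of fibrewise endomaps commutes with base change. -/
lemma isPullback_endBaseChange : IsPullback (endBaseChange h) (endBase p') (endBase p) m := by
  have hs : endBaseChange h ≫ pullback.snd _ _ = pullback.snd _ _ ≫ funBaseChange h :=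
    pullback.lift_snd _ _ _
  refine IsPullback.mk' (pullback.lift_fst _ _ _) ?_ ?_
  · intro T φ φ' e₁ e₂
    refine pullback.hom_ext e₂ (fun_hom_ext_of_funBaseChange h ?_ ?_ ?_)
    · rw [Category.assoc, Category.assoc, end_src, e₂]
    · rw [Category.assoc, Category.assoc, end_tgt, e₂]
    · rw [Category.assoc, Category.assoc, ← hs, reassoc_of% e₁]
  · intro T a b e
    obtain ⟨u, hu₁, hu₂, hu₃⟩ := exists_lift_funBaseChange h b b (a ≫ pullback.snd _ _)
      (by rw [Category.assoc, end_src, e]) (by rw [Category.assoc, end_tgt, e])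
    let l : T ⟶ EndObj p' := pullback.lift b u (by
      apply prod.hom_ext
      · rw [Category.assoc, prod.lift_fst, Category.comp_id, Category.assoc]
        exact hu₁.symm
      · rw [Category.assoc, prod.lift_snd, Category.comp_id, Category.assoc]
        exact hu₂.symm)
    refine ⟨l, pullback.hom_ext ?_ ?_, pullback.lift_fst _ _ _⟩
    · rw [Category.assoc, pullback.lift_fst, pullback.lift_fst_assoc]
      exact e.symm
    · rw [Category.assoc, hs, pullback.lift_snd_assoc, hu₃]

lemma endUnit_endBaseChange : endUnit p' ≫ endBaseChange h = m ≫ endUnit p := by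
  apply pullback.hom_ext
  · rw [Category.assoc, Category.assoc, pullback.lift_fst, endUnit, endUnit, pullback.lift_fst,
      pullback.lift_fst_assoc, Category.id_comp, Category.comp_id]
  · rw [Category.assoc, Category.assoc, pullback.lift_snd, endUnit, endUnit, pullback.lift_snd,
      pullback.lift_snd_assoc, unit_funBaseChange]

/-- The base change map on pairs of fibrewise maps in opposite directions. -/
abbrev end₂BaseChange : EndObj₂ p' ⟶ EndObj₂ p :=
  pullback.map _ _ _ _ (endBaseChange h) (fun₂BaseChange h) (funBaseChange h)
    (pullback.lift_snd _ _ _).symm (mul_funBaseChange h)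

lemma end₂BaseChange_forth : end₂BaseChange h ≫ forth p = forth p' ≫ funBaseChange h := by
  rw [forth, pullback.lift_snd_assoc, Category.assoc, pullback.lift_fst, forth, Category.assoc]

lemma end₂BaseChange_back : end₂BaseChange h ≫ back p = back p' ≫ funBaseChange h := by
  rw [back, pullback.lift_snd_assoc, Category.assoc, pullback.lift_snd, back, Category.assoc]

/-- The base change map on triples. -/
abbrev tripleBaseChange : TripleObj p' ⟶ TripleObj p :=
  pullback.map _ _ _ _ (end₂BaseChange h) (end₂BaseChange h) (funBaseChange h)
    (end₂BaseChange_forth h).symm (end₂BaseChange_back h).symm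

lemma tripleBaseChange_F : tripleBaseChange h ≫ tripleF p = tripleF p' ≫ funBaseChange h := by
  rw [tripleF, pullback.lift_fst_assoc, Category.assoc, end₂BaseChange_forth, tripleF,
    Category.assoc]

lemma tripleBaseChange_G : tripleBaseChange h ≫ tripleG p = tripleG p' ≫ funBaseChange h := by
  rw [tripleG, pullback.lift_fst_assoc, Category.assoc, end₂BaseChange_back, tripleG,
    Category.assoc]

lemma tripleBaseChange_H : tripleBaseChange h ≫ tripleH p = tripleH p' ≫ funBaseChange h := by
  rw [tripleH, pullback.lift_snd_assoc, Category.assoc, end₂BaseChange_forth, tripleH,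
    Category.assoc]

/-- The formation of the object of triples commutes with base change. -/
lemma isPullback_tripleBaseChange :
    IsPullback (tripleBaseChange h) (tripleBase p') (tripleBase p) (prod.map m m) := by
  refine IsPullback.mk' ?_ ?_ ?_
  · rw [tripleBase, tripleBase, reassoc_of% (tripleBaseChange_F h), Category.assoc,
      funBaseChange_funHom h]
  · intro T φ φ' e₁ e₂
    have hs : φ ≫ tripleF p' ≫ src p' = φ' ≫ tripleF p' ≫ src p' := by
      simpa only [Category.assoc, src, tripleBase] using congrArg (· ≫ prod.fst) e₂
    have ht : φ ≫ tripleF p' ≫ tgt p' = φ' ≫ tripleF p' ≫ tgt p' := by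
      simpa only [Category.assoc, tgt, tripleBase] using congrArg (· ≫ prod.snd) e₂
    refine triple_hom_ext (fun_hom_ext_of_funBaseChange h ?_ ?_ ?_)
      (fun_hom_ext_of_funBaseChange h ?_ ?_ ?_) (fun_hom_ext_of_funBaseChange h ?_ ?_ ?_)
    · rw [Category.assoc, Category.assoc, hs]
    · rw [Category.assoc, Category.assoc, ht]
    · rw [Category.assoc, Category.assoc, ← tripleBaseChange_F, reassoc_of% e₁]
    · rw [Category.assoc, Category.assoc, tripleG_src, ht]
    · rw [Category.assoc, Category.assoc, tripleG_tgt, hs]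
    · rw [Category.assoc, Category.assoc, ← tripleBaseChange_G, reassoc_of% e₁]
    · rw [Category.assoc, Category.assoc, tripleH_src, ht]
    · rw [Category.assoc, Category.assoc, tripleH_tgt, hs]
    · rw [Category.assoc, Category.assoc, ← tripleBaseChange_H, reassoc_of% e₁]
  · intro T y x e
    have hs : (y ≫ tripleF p) ≫ src p = (x ≫ prod.fst) ≫ m := by
      simpa only [Category.assoc, src, tripleBase, prod.map_fst] using congrArg (· ≫ prod.fst) e
    have ht : (y ≫ tripleF p) ≫ tgt p = (x ≫ prod.snd) ≫ m := by
      simpa only [Category.assoc, tgt, tripleBase, prod.map_snd] using congrArg (· ≫ prod.snd) e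
    obtain ⟨f, hf₁, hf₂, hf⟩ := exists_lift_funBaseChange h (x ≫ prod.fst) (x ≫ prod.snd)
      (y ≫ tripleF p) hs ht
    obtain ⟨g, hg₁, hg₂, hg⟩ := exists_lift_funBaseChange h (x ≫ prod.snd) (x ≫ prod.fst)
      (y ≫ tripleG p) (by rw [← ht, Category.assoc, Category.assoc, tripleG_src])
      (by rw [← hs, Category.assoc, Category.assoc, tripleG_tgt])
    obtain ⟨k, hk₁, hk₂, hk⟩ := exists_lift_funBaseChange h (x ≫ prod.snd) (x ≫ prod.fst)
      (y ≫ tripleH p) (by rw [← ht, Category.assoc, Category.assoc, tripleH_src])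
      (by rw [← hs, Category.assoc, Category.assoc, tripleH_tgt])
    obtain ⟨u, huf, hug, huk⟩ := triple_exists_lift f g k (hg₁.trans hf₂.symm)
      (hg₂.trans hf₁.symm) (hk₁.trans hf₂.symm) (hk₂.trans hf₁.symm)
    refine ⟨u, triple_hom_ext ?_ ?_ ?_, ?_⟩
    · rw [Category.assoc, tripleBaseChange_F, reassoc_of% huf, hf]
    · rw [Category.assoc, tripleBaseChange_G, reassoc_of% hug, hg]
    · rw [Category.assoc, tripleBaseChange_H, reassoc_of% huk, hk]
    · rw [tripleBase, reassoc_of% huf]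
      apply prod.hom_ext
      · rw [Category.assoc]
        exact hf₁
      · rw [Category.assoc]
        exact hf₂

lemma unitEnd₂_end₂BaseChange : unitEnd₂ p' ≫ end₂BaseChange h = m ≫ unitEnd₂ p := by
  apply end₂_hom_ext
  · rw [Category.assoc, end₂BaseChange_forth, reassoc_of% (unitEnd₂_forth (p := p')),
      unit_funBaseChange, Category.assoc, unitEnd₂_forth]
  · rw [Category.assoc, end₂BaseChange_back, reassoc_of% (unitEnd₂_back (p := p')),
      unit_funBaseChange, Category.assoc, unitEnd₂_back]

lemma unitTriple_tripleBaseChange : unitTriple p' ≫ tripleBaseChange h = m ≫ unitTriple p := by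
  apply pullback.hom_ext
  · rw [Category.assoc, pullback.lift_fst, unitTriple, pullback.lift_fst_assoc,
      unitEnd₂_end₂BaseChange, Category.assoc, unitTriple, pullback.lift_fst]
  · rw [Category.assoc, pullback.lift_snd, unitTriple, pullback.lift_snd_assoc,
      unitEnd₂_end₂BaseChange, Category.assoc, unitTriple, pullback.lift_snd]

/-- The base change map on pairs of parallel fibrewise endomaps. -/
abbrev endPairsBaseChange :
    pullback (endBase p') (endBase p') ⟶ pullback (endBase p) (endBase p) :=
  pullback.map _ _ _ _ (endBaseChange h) (endBaseChange h) m
    (isPullback_endBaseChange h).w.symm (isPullback_endBaseChange h).w.symm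

lemma isPullback_endPairsBaseChange :
    IsPullback (pullback.fst (endBase p') (endBase p')) (endPairsBaseChange h) (endBaseChange h)
      (pullback.fst (endBase p) (endBase p)) := by
  refine IsPullback.of_bot ?_ (pullback.lift_fst _ _ _).symm
    (IsPullback.of_hasPullback (endBase p) (endBase p))
  rw [pullback.lift_snd, (isPullback_endBaseChange h).w]
  exact (IsPullback.of_hasPullback (endBase p') (endBase p')).paste_vert
    (isPullback_endBaseChange h).flip

lemma endPair_endPairsBaseChange :
    endPair p' ≫ endPairsBaseChange h = end₂BaseChange h ≫ endPair p := by
  have e : end₂BaseChange h ≫ endMul p = endMul p' ≫ endBaseChange h := pullback.lift_fst _ _ _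
  apply pullback.hom_ext
  · rw [Category.assoc, Category.assoc, pullback.lift_fst, endPair, endPair,
      pullback.lift_fst_assoc, pullback.lift_fst, e]
  · rw [Category.assoc, Category.assoc, pullback.lift_snd, endPair, endPair,
      pullback.lift_snd_assoc, pullback.lift_snd, reassoc_of% e,
      reassoc_of% (isPullback_endBaseChange h).w, Category.assoc, Category.assoc,
      endUnit_endBaseChange]

/-- The base change square of relative diagonals of the objects of fibrewise endomaps. -/
lemma isPullback_diagonal_endBase :
    IsPullback (pullback.diagonal (endBase p')) (endBaseChange h) (endPairsBaseChange h)
      (pullback.diagonal (endBase p)) := by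
  refine IsPullback.of_right ?_ ?_ (isPullback_endPairsBaseChange h)
  · rw [pullback.diagonal_fst, pullback.diagonal_fst]
    exact IsPullback.id_horiz _
  · apply pullback.hom_ext <;> simp [pullback.lift_fst, pullback.lift_snd]

end InvertibilityData

/-! ### Base change of univalence along truncated fibrations -/

section UnivalenceBaseChange

variable [ModelCategory M] [IsLogicalModelCategory M] {E B E' B' : M} {p : E ⟶ B} [Fibration p]
  {p' : E' ⟶ B'} [Fibration p'] {k : E' ⟶ E} {m : B' ⟶ B}

variable (p) in
/-- The comparison map exhibiting `Equiv(p)` as the object of triples `(f, g, h)` together with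
paths from `g ∘ f` and `f ∘ h` to identities. -/
def equivToPathPairs : EquivObj p ⟶ PathPairs (pullback.fst (forth p) (back p) ≫ endPair p)
    (pullback.snd (forth p) (back p) ≫ endPair p) (endPath p).p :=
  pullback.lift
    (pullback.lift (pullback.map _ _ _ _ (pullback.snd _ _) (pullback.snd _ _) (𝟙 (Fun p))
        (Category.comp_id _) (Category.comp_id _)) (pullback.fst _ _ ≫ pullback.fst _ _)
      (by rw [pullback.lift_fst_assoc, Category.assoc, Category.assoc, ← pullback.condition]))
    (pullback.snd _ _ ≫ pullback.fst _ _)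
    (by rw [pullback.lift_fst_assoc, pullback.lift_snd_assoc, Category.assoc, Category.assoc,
      ← pullback.condition])

variable (p) in
/-- The inverse of `equivToPathPairs`. -/
def pathPairsToEquiv : PathPairs (pullback.fst (forth p) (back p) ≫ endPair p)
    (pullback.snd (forth p) (back p) ≫ endPair p) (endPath p).p ⟶ EquivObj p :=
  pullback.lift
    (pullback.lift (pullback.fst _ _ ≫ pullback.snd _ _)
      (pathPairsBase _ _ _ ≫ pullback.fst _ _)
      (by rw [Category.assoc, ← pullback.condition, Category.assoc, Category.assoc]))
    (pullback.lift (pullback.snd _ _) (pathPairsBase _ _ _ ≫ pullback.snd _ _)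
      (by rw [← pullback.condition, Category.assoc, Category.assoc]))
    (by
      have e := pullback.condition (f := forth p) (g := back p)
      change _ ≫ pullback.snd _ _ ≫ forth p = _ ≫ pullback.snd _ _ ≫ back p
      rw [pullback.lift_snd_assoc, pullback.lift_snd_assoc]
      exact (Category.assoc _ _ _).trans ((congrArg (_ ≫ ·) e).trans (Category.assoc _ _ _).symm))

lemma equivToPathPairs_pathPairsToEquiv : equivToPathPairs p ≫ pathPairsToEquiv p = 𝟙 _ := by
  apply pullback.hom_ext <;> apply pullback.hom_ext <;>
    simp [equivToPathPairs, pathPairsToEquiv, pullback.lift_fst, pullback.lift_snd,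
      pullback.lift_fst_assoc]

lemma pathPairsToEquiv_equivToPathPairs : pathPairsToEquiv p ≫ equivToPathPairs p = 𝟙 _ := by
  apply pullback.hom_ext
  · apply pullback.hom_ext
    · apply pullback.hom_ext <;>
        simp [equivToPathPairs, pathPairsToEquiv, pullback.lift_fst, pullback.lift_snd,
          pullback.lift_fst_assoc, pullback.lift_snd_assoc]
    · simp [equivToPathPairs, pathPairsToEquiv, pullback.lift_fst, pullback.lift_snd,
          pullback.lift_fst_assoc]
  · simp [equivToPathPairs, pathPairsToEquiv, pullback.lift_fst, pullback.lift_snd,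
      pullback.lift_snd_assoc]

instance : IsIso (equivToPathPairs p) :=
  ⟨pathPairsToEquiv p, equivToPathPairs_pathPairsToEquiv, pathPairsToEquiv_equivToPathPairs⟩

variable (p) in
/-- The unit of `Equiv(p)` in terms of triples and pairs of paths. -/
def unitPathPairs : B ⟶ PathPairs (pullback.fst (forth p) (back p) ≫ endPair p)
    (pullback.snd (forth p) (back p) ≫ endPair p) (endPath p).p :=
  unitEquiv p ≫ equivToPathPairs p

lemma unitPathPairs_fst_fst :
    unitPathPairs p ≫ pullback.fst _ _ ≫ pullback.fst _ _ = unitTriple p := by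
  apply pullback.hom_ext
  · simp [unitPathPairs, unitEquiv, unitInv, unitTriple, unitEnd₂, equivToPathPairs,
      pullback.lift_fst, pullback.lift_snd, pullback.lift_fst_assoc]
  · simp [unitPathPairs, unitEquiv, unitInv, unitTriple, unitEnd₂, equivToPathPairs,
      pullback.lift_fst, pullback.lift_snd, pullback.lift_fst_assoc, pullback.lift_snd_assoc]

lemma unitPathPairs_fst_snd :
    unitPathPairs p ≫ pullback.fst _ _ ≫ pullback.snd _ _ = endUnit p ≫ (endPath p).i := by
  simp [unitPathPairs, unitEquiv, unitInv, equivToPathPairs,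
    pullback.lift_fst, pullback.lift_snd, pullback.lift_fst_assoc]

lemma unitPathPairs_snd :
    unitPathPairs p ≫ pullback.snd _ _ = endUnit p ≫ (endPath p).i := by
  simp [unitPathPairs, unitEquiv, unitInv, equivToPathPairs,
    pullback.lift_fst, pullback.lift_snd, pullback.lift_snd_assoc]

lemma weakEquivalence_unitPathPairs_iff :
    WeakEquivalence (unitPathPairs p) ↔ IsUnivalent p :=
  weakEquivalence_postcomp_iff (unitEquiv p) (equivToPathPairs p)

/-- The path object of the object of fibrewise endomaps of `m^*p` maps to that of `p`, and for a
fibration `m` it is equivalent to the pullback of the latter, because by the Frobenius property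
this pullback is a path object as well. -/
lemma exists_endPath_comparison (h : IsPullback k p' p m) [Fibration m] :
    ∃ (l : (endPath p').Z ⟶ (endPath p).Z)
      (hl : (endPath p').p ≫ endPairsBaseChange h = l ≫ (endPath p).p),
      (endPath p').i ≫ l = endBaseChange h ≫ (endPath p).i ∧
        WeakEquivalence (pullback.lift (endPath p').p l hl) := by
  have hd := isPullback_diagonal_endBase h
  have := fibration_of_isPullback (isPullback_endBaseChange h).flip
  have := fibration_of_isPullback (isPullback_endPairsBaseChange h)
  have sq : CommSq (endBaseChange h ≫ (endPath p).i) (endPath p').i (endPath p).p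
      ((endPath p').p ≫ endPairsBaseChange h) :=
    ⟨by rw [Category.assoc, MorphismProperty.MapFactorizationData.fac,
      MorphismProperty.MapFactorizationData.fac_assoc, hd.w]⟩
  refine ⟨sq.lift, sq.fac_right.symm, sq.fac_left, ?_⟩
  let j : EndObj p' ⟶ pullback (endPairsBaseChange h) (endPath p).p :=
    pullback.lift (pullback.diagonal _) (endBaseChange h ≫ (endPath p).i)
      (by rw [Category.assoc, MorphismProperty.MapFactorizationData.fac, hd.w])
  have hj : IsPullback j (endBaseChange h)
      (pullback.snd (endPairsBaseChange h) (endPath p).p) (endPath p).i :=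
    IsPullback.of_right
      (by rw [pullback.lift_fst, MorphismProperty.MapFactorizationData.fac]; exact hd)
      (pullback.lift_snd _ _ _) (IsPullback.of_hasPullback _ _)
  have : WeakEquivalence j := ((mem_trivialCofibrations_iff _).1
    (IsLogicalModelCategory.frobenius hj inferInstance (endPath p).hi)).2
  refine weakEquivalence_of_precomp_of_fac (f := (endPath p').i) (fg := j) ?_
  apply pullback.hom_ext
  · rw [Category.assoc, pullback.lift_fst, pullback.lift_fst,
      MorphismProperty.MapFactorizationData.fac]
  · rw [Category.assoc, pullback.lift_snd, pullback.lift_snd, sq.fac_left]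

/-- The pullback of a univalent fibration along a `(-1)`-truncated fibration is univalent: `B'` is
equivalent to the kernel pair `B' ×_B B'`, which is the pullback of the diagonal of `B`, hence
up to equivalence that of `Equiv(p)`, along `m × m`; and the latter pullback is equivalent to
`Equiv(p')`. -/
lemma isUnivalent_of_isPullback (h : IsPullback k p' p m) [Fibration m]
    (hm : IsTruncatedFibration m) (hp : IsUnivalent p) : IsUnivalent p' := by
  obtain ⟨l, hl, hil, hc⟩ := exists_endPath_comparison h
  have := weakEquivalence_diagonal m hm
  have : WeakEquivalence (unitPathPairs p) := weakEquivalence_unitPathPairs_iff.2 hp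
  have ht := isPullback_tripleBaseChange h
  have := fibration_of_isPullback ht.flip
  have hb : unitPathPairs p ≫ pathPairsBase _ _ _ = unitTriple p := unitPathPairs_fst_fst
  have hb' : unitPathPairs p' ≫ pathPairsBase _ _ _ = unitTriple p' := unitPathPairs_fst_fst
  -- The kernel pair of `m` is the pullback of the diagonal of `B` along `m × m`.
  have hK : IsPullback (pullback.fst m m ≫ m) (prod.lift (pullback.fst m m) (pullback.snd m m))
      (diag B) (prod.map m m) := by
    refine IsPullback.mk' ?_ ?_ ?_
    · apply prod.hom_ext <;> simp [pullback.condition]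
    · intro T φ φ' _ e
      apply pullback.hom_ext
      · simpa [prod.lift_fst] using congrArg (· ≫ prod.fst) e
      · simpa [prod.lift_snd] using congrArg (· ≫ prod.snd) e
    · intro T a b e
      have e₁ : a = b ≫ prod.fst ≫ m := by simpa [prod.lift_fst] using congrArg (· ≫ prod.fst) e
      have e₂ : a = b ≫ prod.snd ≫ m := by simpa [prod.lift_snd] using congrArg (· ≫ prod.snd) e
      refine ⟨pullback.lift (b ≫ prod.fst) (b ≫ prod.snd)
        (by rw [Category.assoc, Category.assoc, ← e₁, ← e₂]), ?_, ?_⟩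
      · rw [pullback.lift_fst_assoc, Category.assoc, ← e₁]
      · apply prod.hom_ext <;> simp [pullback.lift_fst, pullback.lift_snd, prod.lift_fst,
          prod.lift_snd]
  have hS := IsPullback.of_bot' (v₁₂ := unitPathPairs p ≫ pathPairsBase _ _ _)
    (by rw [hb, unitTriple_base]; exact hK) ht
  have h₁ : (pullback.fst (forth p') (back p') ≫ endPair p') ≫ endPairsBaseChange h =
      tripleBaseChange h ≫ pullback.fst (forth p) (back p) ≫ endPair p := by
    rw [Category.assoc, endPair_endPairsBaseChange, pullback.lift_fst_assoc, Category.assoc]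
  have h₂ : (pullback.snd (forth p') (back p') ≫ endPair p') ≫ endPairsBaseChange h =
      tripleBaseChange h ≫ pullback.snd (forth p) (back p) ≫ endPair p := by
    rw [Category.assoc, endPair_endPairsBaseChange, pullback.lift_snd_assoc, Category.assoc]
  have hδ : pullback.diagonal m ≫ (pullback.fst m m ≫ m) = m := by
    rw [pullback.diagonal_fst_assoc]
  rw [← weakEquivalence_unitPathPairs_iff]
  refine weakEquivalence_unit_pathPairs h₁ h₂ hl hS (δ := pullback.diagonal m) ?_ ?_
  · rw [← Category.assoc (pullback.diagonal m), hδ]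
    apply pullback.hom_ext
    · apply pullback.hom_ext
      · have := pathPairsMap_base h₁ h₂ hl
        rw [Category.assoc, Category.assoc, this, ← Category.assoc (unitPathPairs p'), hb',
          unitTriple_tripleBaseChange,
          Category.assoc, Category.assoc, hb]
      · simp only [pathPairsMap, Category.assoc, pullback.lift_fst_assoc, pullback.lift_snd]
        rw [unitPathPairs_fst_snd]
        have := unitPathPairs_fst_snd (p := p')
        rw [reassoc_of% this, hil, reassoc_of% (endUnit_endBaseChange h)]
    · rw [pathPairsMap, Category.assoc, pullback.lift_snd]
      have := unitPathPairs_snd (p := p')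
      rw [reassoc_of% this, hil, reassoc_of% (endUnit_endBaseChange h), Category.assoc,
        unitPathPairs_snd]
  · rw [hb']
    apply ht.hom_ext
    · rw [Category.assoc, ht.lift_fst, ← Category.assoc (pullback.diagonal m), hδ, hb,
        unitTriple_tripleBaseChange]
    · rw [Category.assoc, ht.lift_snd, unitTriple_base]
      apply prod.hom_ext <;> simp

end UnivalenceBaseChange

end UnivalentCompletion

end

theorem proposition5p4 {M : Type u} [Category.{v} M] [ModelCategory M]
    [UnivalentCompletion.IsLogicalModelCategory M]
    [(cofibrations M).IsStableUnderBaseChange]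
    (fibrant_cofibrant : ∀ X : M, IsFibrant X → IsCofibrant X)
    (conn : MorphismProperty M)
    (conn_truncated : UnivalentCompletion.IsHomotopyFactorizationSystem conn
      (UnivalentCompletion.truncatedMaps M))
    {U' U : M} [IsFibrant U] (π : U' ⟶ U) [Fibration π]
    (hπ : UnivalentCompletion.IsUnivalent π)
    {E B : M} [IsFibrant B] (p : E ⟶ B) [Fibration p]
    (hp : UnivalentCompletion.IsSmall π p) :
    (∃ (E' B' : M) (u : E' ⟶ B') (_ : Fibration u) (t : E ⟶ E') (ι : B ⟶ B'),
      UnivalentCompletion.IsUnivalentCompletion conn π p u t ι) ∧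
    ∀ (t : E ⟶ U') (b : B ⟶ U) (ht : UnivalentCompletion.IsHomotopyCartesian t p π b),
      (∃ (B' : M) (ι : B ⟶ B') (m : B' ⟶ U), conn ι ∧ Cofibration ι ∧
        UnivalentCompletion.truncatedMaps M m ∧ Fibration m ∧ ι ≫ m = b) ∧
      ∀ (B' : M) (ι : B ⟶ B') (m : B' ⟶ U), conn ι →
        UnivalentCompletion.truncatedMaps M m → Fibration m → ∀ fac : ι ≫ m = b,
          UnivalentCompletion.IsUnivalentCompletion conn π p (pullback.fst m π)
            (pullback.lift (p ≫ ι) t (by rw [Category.assoc, fac]; exact ht.1)) ι := by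
  have hfac (b : B ⟶ U) : ∃ (B' : M) (ι : B ⟶ B') (m : B' ⟶ U), conn ι ∧ Cofibration ι ∧
      UnivalentCompletion.truncatedMaps M m ∧ Fibration m ∧ ι ≫ m = b := by
    have := fibrant_cofibrant B inferInstance
    have := fibrant_cofibrant U inferInstance
    have := conn_truncated.weakFactorizationSystem
    let d := MorphismProperty.factorizationData
      ((conn ⊓ cofibrations M).inverseImage BifibrantObject.ι)
      ((UnivalentCompletion.truncatedMaps M ⊓ fibrations M).inverseImage BifibrantObject.ι)
      (BifibrantObject.homMk b)
    exact ⟨d.Z.obj, d.i.hom, d.p.hom, d.hi.1, ⟨d.hi.2⟩, d.hp.1, ⟨d.hp.2⟩,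
      congrArg (BifibrantObject.ι.map ·) d.fac⟩
  have hcompl (t : E ⟶ U') (b : B ⟶ U) (ht : UnivalentCompletion.IsHomotopyCartesian t p π b)
      (B' : M) (ι : B ⟶ B') (m : B' ⟶ U) (hι : conn ι)
      (hm : UnivalentCompletion.truncatedMaps M m) (_ : Fibration m) (fac : ι ≫ m = b) :
      UnivalentCompletion.IsUnivalentCompletion conn π p (pullback.fst m π)
        (pullback.lift (p ≫ ι) t (by rw [Category.assoc, fac]; exact ht.1)) ι := by
    obtain ⟨w, hw⟩ := ht
    subst fac
    refine ⟨isFibrant_of_fibration m, ⟨⟨(pullback.lift_fst _ _ _).symm, ?_⟩, hι⟩,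
      ⟨pullback.snd m π, m, pullback.condition, ?_⟩, ?_⟩
    · let e : pullback ι (pullback.fst m π) ⟶ pullback (ι ≫ m) π :=
        (pullbackRightPullbackFstIso m π ι).hom
      refine weakEquivalence_of_postcomp_of_fac (g := e) (fg := pullback.lift p t w) ?_
      apply pullback.hom_ext
      · rw [Category.assoc, pullbackRightPullbackFstIso_hom_fst, pullback.lift_fst,
          pullback.lift_fst]
      · rw [Category.assoc, pullbackRightPullbackFstIso_hom_snd, pullback.lift_snd_assoc,
          pullback.lift_snd, pullback.lift_snd]
    · rw [show pullback.lift (pullback.fst m π) (pullback.snd m π) pullback.condition = 𝟙 _ by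
        apply pullback.hom_ext
        · rw [pullback.lift_fst, Category.id_comp]
        · rw [pullback.lift_snd, Category.id_comp]]
      infer_instance
    -- Truncatedness of the map `m` is applied to its trivial factorization `𝟙 ≫ m`.
    · exact UnivalentCompletion.isUnivalent_of_isPullback (IsPullback.of_hasPullback m π).flip
        (hm B' (𝟙 B') m (mem_trivialCofibrations _) inferInstance (Category.id_comp m)) hπ
  refine ⟨?_, fun t b ht ↦ ⟨hfac b, fun B' ι m hι hm hm' fac ↦ hcompl t b ht B' ι m hι hm hm' fac⟩⟩
  obtain ⟨t, b, ht⟩ := hp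
  obtain ⟨B', ι, m, hι, -, hm, hm', fac⟩ := hfac b
  exact ⟨_, B', pullback.fst m π, inferInstance, _, ι, hcompl t b ht B' ι m hι hm hm' fac⟩
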